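/- Let $\mathcal{T}$ be a small rigid tensor triangulated category, i.e. a small triangulated category with a symmetric monoidal structure $(\otimes,\mathbb{1})$ that is exact in each variable and in which every object has a dual. Its *central ring* is the commutative ring $R_{\mathcal T}=\mathrm{End}_{\mathcal T}(\mathbb 1)$. A *tt-ideal* is a thick subcategory $\mathcal I$ with $\mathcal T\otimes\mathcal I\subset\mathcal I$; it is *prime* if it is proper and $a\otimes b\in\mathcal I$ implies $a\in\mathcal I$ or $b\in\mathcal I$. The *spectrum* $\mathrm{Spec}(\mathcal T)$ is the locally ringed space whose points are the prime tt-ideals, whose topology has the sets $U(a)=\{\mathfrak P\mid a\in\mathfrak P\}$ ($a\in\mathcal T$) as a base, and whose structure sheaf $\mathcal O_{\mathcal T}$ is the sheafification of the presheaf $U\mapsto \mathrm{End}_{\mathcal T/\mathcal T_U}(\mathbb 1)$, where $\mathcal T_U=\bigcap_{\mathfrak P\in U}\mathfrak P$ and $\mathcal T/\mathcal T_U$ is the Verdier quotient (for $U=U(a)$, the ideal $\mathcal T_U$ is the tt-ideal $\langle a\rangle$ generated by $a$). An exact tensor functor $F$ induces a morphism $\mathrm{Spec}(F)$ of locally ringed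 spaces in the opposite direction, given on points by $\mathfrak P\mapsto F^{-1}(\mathfrak P)$. The *comparison morphism* $\rho_{\mathcal T}:\mathrm{Spec}(\mathcal T)\to\mathrm{Spec}(R_{\mathcal T})$ is the morphism of locally ringed spaces that corresponds to the canonical ring homomorphism $R_{\mathcal T}\to\Gamma(\mathrm{Spec}(\mathcal T),\mathcal O_{\mathcal T})$; on points it is $\rho_{\mathcal T}(\mathfrak P)=\{r\in R_{\mathcal T}\mid \mathrm{cone}(r)\notin\mathfrak P\}$. Let $S\subset R_{\mathcal T}$ be a multiplicative system, and let $Q:\mathcal T\to S^{-1}\mathcal T$ be the localization obtained by inverting the morphisms $s\cdot\mathrm{id}_a$ ($s\in S$, $a\in\mathcal T$), with its induced tensor triangulated structure. Then: 1. The homomorphism $R_{\mathcal T}\to R_{S^{-1}\mathcal T}$ induced by $Q$ exhibits $R_{S^{-1}\mathcal T}$ as the localization $S^{-1}R_{\mathcal T}$. 2. The square $$\begin{array}{ccc}\mathrm{Spec}(S^{-1}\mathcal T)&\xrightarrow{\ \mathrm{Spec}(Q)\ }&\mathrm{Spec}(\mathcal T)\\ {\scriptstyle\rho_{S^{-1}\mathcal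 T}}\downarrow&&\downarrow{\scriptstyle\rho_{\mathcal T}}\\ \mathrm{Spec}(R_{S^{-1}\mathcal T})=\mathrm{Spec}(S^{-1}R_{\mathcal T})&\longrightarrow&\mathrm{Spec}(R_{\mathcal T})\end{array}$$ is cartesian in the category of locally ringed spaces. 3. Explicitly, the map $f$ underlying $\mathrm{Spec}(Q)$ is a homeomorphism of $\mathrm{Spec}(S^{-1}\mathcal T)$ onto the subspace $\{\mathfrak P\in\mathrm{Spec}(\mathcal T)\mid\rho_{\mathcal T}(\mathfrak P)\cap S=\emptyset\}$, and the canonical morphism $f^{-1}\mathcal O_{\mathcal T}\to\mathcal O_{S^{-1}\mathcal T}$ is an isomorphism, i.e. the structure sheaf of $\mathrm{Spec}(S^{-1}\mathcal T)$ is the restriction of $\mathcal O_{\mathcal T}$ to this subspace. -/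

import Mathlib

open CategoryTheory MonoidalCategory Limits Pretriangulated TopologicalSpace Opposite

universe v u

set_option linter.unusedSectionVars false

namespace TTGeometry

section Basic

variable (T : Type u) [Category.{v} T] [HasZeroObject T] [HasShift T ℤ] [Preadditive T]
  [∀ n : ℤ, (shiftFunctor T n).Additive] [Pretriangulated T]
  [MonoidalCategory T] [SymmetricCategory T]

/-- The tensor product of a triangulated category is exact in each variable: it is biadditive,
there are isomorphisms `a ⊗ Σb ≅ Σ(a ⊗ b)`, natural in `a` and in `b`, and together with them every
functor `a ⊗ -` preserves distinguished triangles. (For `- ⊗ a` the same follows by symmetry.) -/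
class IsTensorTriangulated : Prop extends MonoidalPreadditive T where
  exact_tensor : ∃ σ : ∀ a b : T, a ⊗ b⟦(1 : ℤ)⟧ ≅ (a ⊗ b)⟦(1 : ℤ)⟧,
    (∀ (a : T) {b b' : T} (f : b ⟶ b'),
      a ◁ f⟦(1 : ℤ)⟧' ≫ (σ a b').hom = (σ a b).hom ≫ (a ◁ f)⟦(1 : ℤ)⟧') ∧
    (∀ {a a' : T} (f : a ⟶ a') (b : T),
      f ▷ b⟦(1 : ℤ)⟧ ≫ (σ a' b).hom = (σ a b).hom ≫ (f ▷ b)⟦(1 : ℤ)⟧') ∧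
    ∀ (a : T) (X : Triangle T), X ∈ (distTriang T) →
      Triangle.mk (a ◁ X.mor₁) (a ◁ X.mor₂) (a ◁ X.mor₃ ≫ (σ a X.obj₁).hom) ∈ (distTriang T)

variable {T}

/-- A tt-ideal: a thick subcategory `I` with `T ⊗ I ⊆ I`. -/
class IsTTIdeal (I : ObjectProperty T) : Prop extends
    I.IsTriangulated, I.IsStableUnderRetracts where
  tensor_mem : ∀ a b : T, I b → I (a ⊗ b)

instance (I : ObjectProperty T) [IsTTIdeal I] : I.IsClosedUnderIsomorphisms where
  of_iso e h := I.prop_of_retract e.symm.retract h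

lemma IsTTIdeal.tensor_mem' (I : ObjectProperty T) [IsTTIdeal I] (a b : T) (h : I a) :
    I (a ⊗ b) :=
  I.prop_of_iso (β_ b a) (IsTTIdeal.tensor_mem b a h)

variable [IsTensorTriangulated T] [IsTriangulated T]

instance (I : ObjectProperty T) [IsTTIdeal I] : I.trW.IsMonoidal := by
  obtain ⟨σ, -, -, h⟩ := IsTensorTriangulated.exact_tensor (T := T)
  have key : ∀ (X : T) {Y₁ Y₂ : T} (g : Y₁ ⟶ Y₂), I.trW g → I.trW (X ◁ g) := by
    rintro X Y₁ Y₂ g ⟨Z, a, b, hT, hZ⟩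
    exact ⟨_, _, _, h X _ hT, IsTTIdeal.tensor_mem X Z hZ⟩
  refine { whiskerLeft := fun X _ _ g hg => key X g hg, whiskerRight := ?_ }
  intro X₁ X₂ f hf Y
  have : f ▷ Y = (β_ X₁ Y).hom ≫ Y ◁ f ≫ (β_ X₂ Y).inv := by simp
  rw [this]
  exact (MorphismProperty.cancel_left_of_respectsIso _ _ _).2
    ((MorphismProperty.cancel_right_of_respectsIso _ _ _).2 (key Y f hf))

end Basic

section Quotient

open Localization Localization.Monoidal

variable {T : Type u} [Category.{v} T] [HasZeroObject T] [HasShift T ℤ] [Preadditive T]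
  [∀ n : ℤ, (shiftFunctor T n).Additive] [Pretriangulated T]
  [MonoidalCategory T] [SymmetricCategory T] [IsTensorTriangulated T] [IsTriangulated T]
  {D : Type u} [Category.{v} D] (L : T ⥤ D) (I : ObjectProperty T) [IsTTIdeal I]
  [L.IsLocalization I.trW]

/-- If `L : T ⥤ D` is a localization functor for the morphisms whose cone lies in `I`
(i.e. `D` is a model of the Verdier quotient `T / I`), this is `D` with the induced structure of a
tensor triangulated category, with unit `L.obj (𝟙_ T)`. -/
abbrev TTQuotient : Type u := LocalizedMonoidal L I.trW (Iso.refl (L.obj (𝟙_ T)))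

/-- The quotient functor to the tensor triangulated category `TTQuotient L I`. -/
abbrev toTTQuotient : T ⥤ TTQuotient L I :=
  toMonoidalCategory L I.trW (Iso.refl (L.obj (𝟙_ T)))

noncomputable instance : Preadditive (TTQuotient L I) :=
  Localization.preadditive (toTTQuotient L I) I.trW

instance : (toTTQuotient L I).Additive := Localization.functor_additive (toTTQuotient L I) I.trW

instance : HasZeroObject (TTQuotient L I) := (toTTQuotient L I).hasZeroObject_of_additive

noncomputable instance : HasShift (TTQuotient L I) ℤ := HasShift.localized (toTTQuotient L I) I.trW ℤ

noncomputable instance : (toTTQuotient L I).CommShift ℤ :=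
  Functor.CommShift.localized (toTTQuotient L I) I.trW ℤ

instance (n : ℤ) : (shiftFunctor (TTQuotient L I) n).Additive := by
  rw [Localization.functor_additive_iff (toTTQuotient L I) I.trW]
  exact Functor.additive_of_iso ((toTTQuotient L I).commShiftIso n)

noncomputable instance : Pretriangulated (TTQuotient L I) :=
  Triangulated.Localization.pretriangulated (toTTQuotient L I) I.trW

instance : (toTTQuotient L I).IsTriangulated :=
  Triangulated.Localization.isTriangulated_functor (toTTQuotient L I) I.trW

instance : IsTriangulated (TTQuotient L I) :=
  Triangulated.Localization.isTriangulated (toTTQuotient L I) I.trW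

instance : (toTTQuotient L I).EssSurj := Localization.essSurj _ I.trW

instance : MonoidalPreadditive (TTQuotient L I) := by
  have hl : ∀ X : TTQuotient L I, (tensorLeft X).Additive := by
    intro X
    obtain ⟨x, ⟨e⟩⟩ : ∃ x, Nonempty ((toTTQuotient L I).obj x ≅ X) :=
      ⟨_, ⟨(toTTQuotient L I).objObjPreimageIso X⟩⟩
    have : (tensorLeft ((toTTQuotient L I).obj x)).Additive := by
      rw [Localization.functor_additive_iff (toTTQuotient L I) I.trW]
      exact Functor.additive_of_iso (F := tensorLeft x ⋙ toTTQuotient L I)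
        (NatIso.ofComponents (fun y => (Functor.Monoidal.μIso (toTTQuotient L I) x y).symm)
          (by intros; simp [Functor.OplaxMonoidal.δ_natural_right]))
    exact Functor.additive_of_iso ((curriedTensor _).mapIso e)
  have hr : ∀ X : TTQuotient L I, (tensorRight X).Additive := fun X =>
    Functor.additive_of_iso (BraidedCategory.tensorLeftIsoTensorRight X)
  exact
    { whiskerLeft_zero := fun {X Y Z} => (tensorLeft X).map_zero Y Z
      zero_whiskerRight := fun {X Y Z} => (tensorRight X).map_zero Y Z
      whiskerLeft_add := fun {X Y Z} f g => (tensorLeft X).map_add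
      add_whiskerRight := fun {X Y Z} f g => (tensorRight X).map_add }

end Quotient

section Quotient

open Localization Localization.Monoidal

variable {T : Type u} [Category.{v} T] [HasZeroObject T] [HasShift T ℤ] [Preadditive T]
  [∀ n : ℤ, (shiftFunctor T n).Additive] [Pretriangulated T]
  [MonoidalCategory T] [SymmetricCategory T] [IsTensorTriangulated T] [IsTriangulated T]
  {D : Type u} [Category.{v} D] (L : T ⥤ D) (I : ObjectProperty T) [IsTTIdeal I]
  [L.IsLocalization I.trW]

/-- The bifunctor `(a, b) ↦ a ⊗ Σb`. -/
abbrev tensorShift (C : Type u) [Category.{v} C] [HasShift C ℤ] [MonoidalCategory C] :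
    C ⥤ C ⥤ C :=
  curriedTensor C ⋙ (Functor.whiskeringLeft _ _ _).obj (shiftFunctor C (1 : ℤ))

/-- The bifunctor `(a, b) ↦ Σ(a ⊗ b)`. -/
abbrev shiftTensor (C : Type u) [Category.{v} C] [HasShift C ℤ] [MonoidalCategory C] :
    C ⥤ C ⥤ C :=
  curriedTensor C ⋙ (Functor.whiskeringRight _ _ _).obj (shiftFunctor C (1 : ℤ))

lemma exists_shiftIso_quotient (σ : ∀ a b : T, a ⊗ b⟦(1 : ℤ)⟧ ≅ (a ⊗ b)⟦(1 : ℤ)⟧)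
    (h1 : ∀ (a : T) {b b' : T} (f : b ⟶ b'),
      a ◁ f⟦(1 : ℤ)⟧' ≫ (σ a b').hom = (σ a b).hom ≫ (a ◁ f)⟦(1 : ℤ)⟧')
    (h2 : ∀ {a a' : T} (f : a ⟶ a') (b : T),
      f ▷ b⟦(1 : ℤ)⟧ ≫ (σ a' b).hom = (σ a b).hom ≫ (f ▷ b)⟦(1 : ℤ)⟧') :
    ∃ τ : tensorShift (TTQuotient L I) ≅ shiftTensor (TTQuotient L I), ∀ a b : T,
      (τ.hom.app ((toTTQuotient L I).obj a)).app ((toTTQuotient L I).obj b) =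
        (toTTQuotient L I).obj a ◁ ((toTTQuotient L I).commShiftIso (1 : ℤ)).inv.app b ≫
          Functor.LaxMonoidal.μ (toTTQuotient L I) a (b⟦(1 : ℤ)⟧) ≫ (toTTQuotient L I).map (σ a b).hom ≫
          ((toTTQuotient L I).commShiftIso (1 : ℤ)).hom.app (a ⊗ b) ≫
          (Functor.OplaxMonoidal.δ (toTTQuotient L I) a b)⟦(1 : ℤ)⟧' := by
  let F := (((Functor.whiskeringLeft₂ (TTQuotient L I)).obj (toTTQuotient L I)).obj (toTTQuotient L I)).obj (tensorShift (TTQuotient L I))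
  let G := (((Functor.whiskeringLeft₂ (TTQuotient L I)).obj (toTTQuotient L I)).obj (toTTQuotient L I)).obj (shiftTensor (TTQuotient L I))
  let _ : Lifting₂ (toTTQuotient L I) (toTTQuotient L I) I.trW I.trW F (tensorShift (TTQuotient L I)) := ⟨Iso.refl _⟩
  let _ : Lifting₂ (toTTQuotient L I) (toTTQuotient L I) I.trW I.trW G (shiftTensor (TTQuotient L I)) := ⟨Iso.refl _⟩
  let e : ∀ a b : T, (F.obj a).obj b ≅ (G.obj a).obj b := fun a b =>
    whiskerLeftIso ((toTTQuotient L I).obj a) (((toTTQuotient L I).commShiftIso (1 : ℤ)).symm.app b) ≪≫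
      Functor.Monoidal.μIso (toTTQuotient L I) a (b⟦(1 : ℤ)⟧) ≪≫ (toTTQuotient L I).mapIso (σ a b) ≪≫
      ((toTTQuotient L I).commShiftIso (1 : ℤ)).app (a ⊗ b) ≪≫
      (shiftFunctor (TTQuotient L I) (1 : ℤ)).mapIso (Functor.Monoidal.μIso (toTTQuotient L I) a b).symm
  have he : ∀ a b, (e a b).hom = (toTTQuotient L I).obj a ◁ ((toTTQuotient L I).commShiftIso (1 : ℤ)).inv.app b ≫
          Functor.LaxMonoidal.μ (toTTQuotient L I) a (b⟦(1 : ℤ)⟧) ≫ (toTTQuotient L I).map (σ a b).hom ≫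
          ((toTTQuotient L I).commShiftIso (1 : ℤ)).hom.app (a ⊗ b) ≫
          (Functor.OplaxMonoidal.δ (toTTQuotient L I) a b)⟦(1 : ℤ)⟧' := fun a b => rfl
  let τ₀ : F ≅ G := NatIso.ofComponents (fun a => NatIso.ofComponents (fun b => e a b)
      (by
        intro b b' f
        rw [he, he]
        change (toTTQuotient L I).obj a ◁ ((toTTQuotient L I).map f)⟦(1 : ℤ)⟧' ≫ _ = _ ≫ ((toTTQuotient L I).obj a ◁ (toTTQuotient L I).map f)⟦(1 : ℤ)⟧'
        have n1 : ((toTTQuotient L I).map f)⟦(1 : ℤ)⟧' ≫ ((toTTQuotient L I).commShiftIso (1 : ℤ)).inv.app b' =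
            ((toTTQuotient L I).commShiftIso (1 : ℤ)).inv.app b ≫ (toTTQuotient L I).map (f⟦(1 : ℤ)⟧') :=
          ((toTTQuotient L I).commShiftIso (1 : ℤ)).inv.naturality f
        have n2 := ((toTTQuotient L I).commShiftIso (1 : ℤ)).hom.naturality (a ◁ f)
        simp only [Functor.comp_map] at n2
        rw [← MonoidalCategory.whiskerLeft_comp_assoc, n1, MonoidalCategory.whiskerLeft_comp_assoc]
        rw [Functor.LaxMonoidal.μ_natural_right_assoc, ← Functor.map_comp_assoc, h1,
          Functor.map_comp_assoc, reassoc_of% n2]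
        simp only [Category.assoc, ← Functor.map_comp]
        rw [Functor.OplaxMonoidal.δ_natural_right]))
    (by
      intro a a' f
      ext b
      change (toTTQuotient L I).map f ▷ _ ≫ (e a' b).hom = (e a b).hom ≫ ((toTTQuotient L I).map f ▷ (toTTQuotient L I).obj b)⟦(1 : ℤ)⟧'
      rw [he, he]
      have n2 := ((toTTQuotient L I).commShiftIso (1 : ℤ)).hom.naturality (f ▷ b)
      simp only [Functor.comp_map] at n2
      rw [← MonoidalCategory.whisker_exchange_assoc]
      change _ ◁ _ ≫ (toTTQuotient L I).map f ▷ (toTTQuotient L I).obj (b⟦(1 : ℤ)⟧) ≫ _ = _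
      rw [Functor.LaxMonoidal.μ_natural_left_assoc,
        ← Functor.map_comp_assoc, h2, Functor.map_comp_assoc, reassoc_of% n2]
      simp only [Category.assoc, ← Functor.map_comp]
      rw [Functor.OplaxMonoidal.δ_natural_left])
  refine ⟨lift₂NatIso (toTTQuotient L I) (toTTQuotient L I) I.trW I.trW F G _ _ τ₀, fun a b => ?_⟩
  rw [lift₂NatIso_hom, lift₂NatTrans_app_app]
  change 𝟙 _ ≫ (e a b).hom ≫ 𝟙 _ = _
  rw [Category.id_comp, Category.comp_id, he]

instance : IsTensorTriangulated (TTQuotient L I) where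
  exact_tensor := by
    obtain ⟨σ, h1, h2, h3⟩ := IsTensorTriangulated.exact_tensor (T := T)
    obtain ⟨τ, hτ⟩ := exists_shiftIso_quotient L I σ h1 h2
    have n1 : ∀ (a : (TTQuotient L I)) {b b' : (TTQuotient L I)} (f : b ⟶ b'), a ◁ f⟦(1 : ℤ)⟧' ≫ (τ.hom.app a).app b' =
        (τ.hom.app a).app b ≫ (a ◁ f)⟦(1 : ℤ)⟧' := fun a b b' f => (τ.hom.app a).naturality f
    have n2 : ∀ {a a' : (TTQuotient L I)} (f : a ⟶ a') (b : (TTQuotient L I)), f ▷ b⟦(1 : ℤ)⟧ ≫ (τ.hom.app a').app b =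
        (τ.hom.app a).app b ≫ (f ▷ b)⟦(1 : ℤ)⟧' := fun f b =>
      congr_app (τ.hom.naturality f) b
    refine ⟨fun a b => (τ.app a).app b, n1, n2, ?_⟩
    rintro a X ⟨Y, e, hY⟩
    obtain ⟨x, ⟨i⟩⟩ : ∃ x, Nonempty ((toTTQuotient L I).obj x ≅ a) :=
      ⟨_, ⟨(toTTQuotient L I).objObjPreimageIso a⟩⟩
    obtain ⟨e₁, he₁⟩ : ∃ e₁ : X.obj₁ ≅ (toTTQuotient L I).obj Y.obj₁, e₁.hom = e.hom.hom₁ :=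
      ⟨Triangle.π₁.mapIso e, rfl⟩
    obtain ⟨e₂, he₂⟩ : ∃ e₂ : X.obj₂ ≅ (toTTQuotient L I).obj Y.obj₂, e₂.hom = e.hom.hom₂ :=
      ⟨Triangle.π₂.mapIso e, rfl⟩
    obtain ⟨e₃, he₃⟩ : ∃ e₃ : X.obj₃ ≅ (toTTQuotient L I).obj Y.obj₃, e₃.hom = e.hom.hom₃ :=
      ⟨Triangle.π₃.mapIso e, rfl⟩
    have c1 : X.mor₁ ≫ e₂.hom = e₁.hom ≫ (toTTQuotient L I).map Y.mor₁ := by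
      rw [he₁, he₂]; exact e.hom.comm₁
    have c2 : X.mor₂ ≫ e₃.hom = e₂.hom ≫ (toTTQuotient L I).map Y.mor₂ := by
      rw [he₂, he₃]; exact e.hom.comm₂
    have c3 : X.mor₃ ≫ e₁.hom⟦(1 : ℤ)⟧' =
        e₃.hom ≫ (toTTQuotient L I).map Y.mor₃ ≫ ((toTTQuotient L I).commShiftIso (1 : ℤ)).hom.app Y.obj₁ := by
      rw [he₁, he₃]; exact e.hom.comm₃
    let E : ∀ {b : (TTQuotient L I)} {y : T} (_ : b ≅ (toTTQuotient L I).obj y), a ⊗ b ≅ (toTTQuotient L I).obj (x ⊗ y) := fun {b y} j =>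
      (i.symm ⊗ᵢ j) ≪≫ Functor.Monoidal.μIso (toTTQuotient L I) x y
    have hE : ∀ {b b' : (TTQuotient L I)} {y y' : T} (j : b ≅ (toTTQuotient L I).obj y) (j' : b' ≅ (toTTQuotient L I).obj y')
        (f : b ⟶ b') (g : y ⟶ y') (_ : f ≫ j'.hom = j.hom ≫ (toTTQuotient L I).map g),
        a ◁ f ≫ (E j').hom = (E j).hom ≫ (toTTQuotient L I).map (x ◁ g) := by
      intro b b' y y' j j' f g hfg
      simp only [E, Iso.trans_hom, tensorIso_hom, Iso.symm_hom, Functor.Monoidal.μIso_hom,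
        Category.assoc]
      rw [← Functor.LaxMonoidal.μ_natural_right, MonoidalCategory.tensorHom_def', MonoidalCategory.tensorHom_def']
      simp only [Category.assoc]
      rw [← MonoidalCategory.whiskerLeft_comp_assoc, hfg, MonoidalCategory.whiskerLeft_comp_assoc,
        MonoidalCategory.whisker_exchange_assoc]
    have nτ : ∀ {b : (TTQuotient L I)} {y : T} (j : b ≅ (toTTQuotient L I).obj y), (τ.hom.app a).app b ≫ (E j).hom⟦(1 : ℤ)⟧' =
        (i.inv ⊗ₘ j.hom⟦(1 : ℤ)⟧') ≫ (toTTQuotient L I).obj x ◁ ((toTTQuotient L I).commShiftIso (1 : ℤ)).inv.app y ≫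
          Functor.LaxMonoidal.μ (toTTQuotient L I) x (y⟦(1 : ℤ)⟧) ≫ (toTTQuotient L I).map (σ x y).hom ≫
          ((toTTQuotient L I).commShiftIso (1 : ℤ)).hom.app (x ⊗ y) := by
      intro b y j
      simp only [E, Iso.trans_hom, tensorIso_hom, Iso.symm_hom, Functor.Monoidal.μIso_hom,
        Functor.map_comp]
      rw [MonoidalCategory.tensorHom_def, MonoidalCategory.tensorHom_def, Functor.map_comp, Category.assoc, Category.assoc,
        ← reassoc_of% (n2 i.inv b), ← reassoc_of% (n1 ((toTTQuotient L I).obj x) j.hom), hτ]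
      simp only [Category.assoc, ← Functor.map_comp, Functor.Monoidal.δ_μ]
      simp
    refine isomorphic_distinguished _ ((toTTQuotient L I).map_distinguished _ (h3 x Y hY)) _ ?_
    refine Triangle.isoMk _ _ (E e₁) (E e₂) (E e₃) (hE _ _ _ _ c1) (hE _ _ _ _ c2) ?_
    change (a ◁ X.mor₃ ≫ (τ.hom.app a).app X.obj₁) ≫ (E e₁).hom⟦(1 : ℤ)⟧' =
      (E e₃).hom ≫ (toTTQuotient L I).map (x ◁ Y.mor₃ ≫ (σ x Y.obj₁).hom) ≫
        ((toTTQuotient L I).commShiftIso (1 : ℤ)).hom.app (x ⊗ Y.obj₁)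
    rw [Category.assoc, nτ]
    simp only [E, Iso.trans_hom, tensorIso_hom, Iso.symm_hom, Functor.Monoidal.μIso_hom,
      Category.assoc, Functor.map_comp]
    rw [← Functor.LaxMonoidal.μ_natural_right_assoc, MonoidalCategory.tensorHom_def',
      MonoidalCategory.tensorHom_def']
    simp only [Category.assoc]
    rw [← MonoidalCategory.whiskerLeft_comp_assoc, c3]
    simp only [MonoidalCategory.whiskerLeft_comp, Category.assoc]
    rw [← MonoidalCategory.whisker_exchange_assoc, ← MonoidalCategory.whiskerLeft_comp_assoc,
      ← MonoidalCategory.whiskerLeft_comp_assoc, ← MonoidalCategory.whisker_exchange_assoc]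
    simp

end Quotient

section CentralRing

variable {T : Type u} [Category.{v} T] [MonoidalCategory T]

lemma end_unit_mul_comm (f g : End (𝟙_ T)) : f * g = g * f := by
  have hf : f = (ρ_ (𝟙_ T)).inv ≫ f ▷ 𝟙_ T ≫ (ρ_ (𝟙_ T)).hom := by simp
  have hg : g = (ρ_ (𝟙_ T)).inv ≫ 𝟙_ T ◁ g ≫ (ρ_ (𝟙_ T)).hom := by
    simp [← unitors_equal, ← unitors_inv_equal]
  change g ≫ f = f ≫ g
  have h := whisker_exchange f g
  rw [hf, hg]
  simp only [Category.assoc, Iso.hom_inv_id_assoc]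
  rw [reassoc_of% h]

/-- The central ring of `T` is the endomorphism ring of the unit. -/
instance [Preadditive T] : CommRing (End (𝟙_ T)) :=
  { (inferInstance : Ring (End (𝟙_ T))) with mul_comm := end_unit_mul_comm }

/-- The action of the central ring on an object `a`: the endomorphism `r ⊗ a` of `a ≅ 𝟙 ⊗ a`. -/
def act (r : End (𝟙_ T)) (a : T) : a ⟶ a := (λ_ a).inv ≫ r ▷ a ≫ (λ_ a).hom

lemma act_naturality (r : End (𝟙_ T)) {a b : T} (f : a ⟶ b) : act r a ≫ f = f ≫ act r b := by
  simp only [act, Category.assoc]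
  rw [← leftUnitor_naturality, ← whisker_exchange_assoc, leftUnitor_inv_naturality_assoc]

lemma act_naturality_assoc (r : End (𝟙_ T)) {a b c : T} (f : a ⟶ b) (g : b ⟶ c) :
    act r a ≫ f ≫ g = f ≫ act r b ≫ g := by
  rw [← Category.assoc, act_naturality, Category.assoc]

lemma act_mul (r s : End (𝟙_ T)) (a : T) : act (r * s) a = act s a ≫ act r a := by
  simp only [act, Category.assoc, Iso.hom_inv_id_assoc]
  change (λ_ a).inv ≫ (s ≫ r) ▷ a ≫ _ = _
  rw [comp_whiskerRight_assoc]

lemma act_one (a : T) : act (1 : End (𝟙_ T)) a = 𝟙 a := by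
  change (λ_ a).inv ≫ (𝟙 (𝟙_ T)) ▷ a ≫ _ = _
  simp

lemma act_unit (r : End (𝟙_ T)) : act r (𝟙_ T) = r := by
  have hr := rightUnitor_naturality r
  rw [act, unitors_equal, hr, unitors_inv_equal, Iso.inv_hom_id_assoc]

lemma act_add [Preadditive T] [MonoidalPreadditive T] (r s : End (𝟙_ T)) (a : T) :
    act (r + s) a = act r a + act s a := by
  simp only [act]
  rw [MonoidalPreadditive.add_whiskerRight]
  simp

lemma act_tensor (r : End (𝟙_ T)) (a b : T) : act r (a ⊗ b) = act r a ▷ b := by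
  simp [act]

lemma act_tensor' [BraidedCategory T] (r : End (𝟙_ T)) (a b : T) :
    act r (a ⊗ b) = a ◁ act r b := by
  rw [← cancel_mono (β_ a b).hom, act_naturality, act_tensor,
    BraidedCategory.braiding_naturality_right]

end CentralRing

section CentralLocalization

variable {T : Type u} [Category.{v} T] [HasZeroObject T] [HasShift T ℤ] [Preadditive T]
  [∀ n : ℤ, (shiftFunctor T n).Additive] [Pretriangulated T]
  [MonoidalCategory T] [SymmetricCategory T] [IsTensorTriangulated T]

lemma act_shift (r : End (𝟙_ T)) (a : T) : act r (a⟦(1 : ℤ)⟧) = (act r a)⟦(1 : ℤ)⟧' := by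
  obtain ⟨σ, -, h, -⟩ := IsTensorTriangulated.exact_tensor (T := T)
  let ψ : a⟦(1 : ℤ)⟧ ≅ a⟦(1 : ℤ)⟧ :=
    (λ_ _).symm ≪≫ σ (𝟙_ T) a ≪≫ (shiftFunctor T (1 : ℤ)).mapIso (λ_ a)
  have h1 := act_naturality r ψ.hom
  rw [← cancel_epi ψ.hom, ← h1]
  simp only [ψ, act, Iso.trans_hom, Iso.symm_hom, Functor.mapIso_hom, Category.assoc,
    Iso.hom_inv_id_assoc, Functor.map_comp]
  rw [reassoc_of% (h r a), ← (shiftFunctor T (1 : ℤ)).map_comp_assoc, Iso.hom_inv_id,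
    CategoryTheory.Functor.map_id, Category.id_comp]

lemma act_eq_zero_of_retract (s : End (𝟙_ T)) {a b : T} (h : Retract a b) (h0 : act s b = 0) :
    act s a = 0 := by
  rw [← Category.comp_id (act s a), ← h.retract, act_naturality_assoc, h0]
  simp

lemma act_shift_eq_zero (s : End (𝟙_ T)) {a : T} (h : act s a = 0) (n : ℤ) :
    act s (a⟦n⟧) = 0 := by
  have shift1 : ∀ a : T, act s a = 0 ↔ act s (a⟦(1 : ℤ)⟧) = 0 := by
    intro a
    refine ⟨fun h => by rw [act_shift, h, Functor.map_zero], fun h => ?_⟩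
    refine (shiftFunctor T (1 : ℤ)).map_injective ?_
    rw [← act_shift, h, Functor.map_zero]
  induction n using Int.induction_on generalizing a with
  | zero => exact act_eq_zero_of_retract s ((shiftFunctorZero T ℤ).app a).retract h
  | succ n ih =>
    exact act_eq_zero_of_retract s ((shiftFunctorAdd T (n : ℤ) 1).app a).retract
      ((shift1 _).1 (ih h))
  | pred n ih =>
    rw [shift1]
    exact act_eq_zero_of_retract s
      ((shiftFunctorAdd' T (-(n : ℤ) - 1) 1 (-(n : ℤ)) (by ring)).app a).symm.retract (ih h)

/-- The morphisms `s : a ⟶ a` for `s ∈ S` and `a` an object of `T`. -/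
def centralMorphisms (S : Submonoid (End (𝟙_ T))) : MorphismProperty T :=
  MorphismProperty.ofHoms (fun x : S × T => act (x.1 : End (𝟙_ T)) x.2)

/-- The objects annihilated by some element of `S`. -/
def torsion (S : Submonoid (End (𝟙_ T))) : ObjectProperty T :=
  fun a => ∃ s ∈ S, act s a = 0

instance (S : Submonoid (End (𝟙_ T))) : IsTTIdeal (torsion S) :=
  haveI : (torsion S).IsStableUnderRetracts :=
    ⟨by
      rintro X Y h ⟨s, hs, h0⟩
      exact ⟨s, hs, act_eq_zero_of_retract s h h0⟩⟩
  haveI : (torsion S).IsClosedUnderIsomorphisms :=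
    ⟨fun e h => (torsion S).prop_of_retract e.symm.retract h⟩
  haveI : (torsion S).ContainsZero :=
    ⟨⟨HasZeroObject.zero' T |>.1, isZero_zero T, 1, S.one_mem, (isZero_zero T).eq_of_src _ _⟩⟩
  haveI : (torsion S).IsStableUnderShift ℤ := ⟨fun n => ⟨fun a h =>
    ⟨h.choose, h.choose_spec.1, act_shift_eq_zero _ h.choose_spec.2 n⟩⟩⟩
  haveI : (torsion S).IsTriangulatedClosed₂ := .mk' (by
    rintro X hX ⟨s, hs, h1⟩ ⟨t, ht, h3⟩
    refine ⟨s * t, S.mul_mem hs ht, ?_⟩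
    obtain ⟨g, hg⟩ := Triangle.coyoneda_exact₂ X hX (act t X.obj₂)
      (by rw [act_naturality, h3, comp_zero])
    rw [act_mul, hg, Category.assoc, ← act_naturality, h1, zero_comp, comp_zero])
  { tensor_mem := by
      rintro a b ⟨s, hs, h⟩
      exact ⟨s, hs, by rw [act_tensor', h, MonoidalPreadditive.whiskerLeft_zero]⟩ }

lemma act_mem_trW (S : Submonoid (End (𝟙_ T))) (s : End (𝟙_ T)) (hs : s ∈ S) (a : T) :
    (torsion S).trW (act s a) := by
  obtain ⟨c, p, q, hT⟩ := distinguished_cocone_triangle (act s a)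
  refine ⟨c, p, q, hT, s * s, S.mul_mem hs hs, ?_⟩
  have hpq : p ≫ act s c = 0 := by
    rw [← act_naturality]
    exact comp_distTriang_mor_zero₁₂ _ hT
  obtain ⟨g, hg⟩ : ∃ g : a⟦(1 : ℤ)⟧ ⟶ c, act s c = q ≫ g :=
    Triangle.yoneda_exact₃ _ hT (act s c) hpq
  have hq : q ≫ act s (a⟦(1 : ℤ)⟧) = 0 := by
    rw [act_shift]
    exact comp_distTriang_mor_zero₃₁ _ hT
  rw [act_mul]
  nth_rw 1 [hg]
  rw [Category.assoc, ← act_naturality, reassoc_of% hq, zero_comp]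

lemma centralMorphisms_le_trW (S : Submonoid (End (𝟙_ T))) :
    centralMorphisms S ≤ (torsion S).trW := by
  rw [centralMorphisms, MorphismProperty.ofHoms_le_iff]
  exact fun x => act_mem_trW S x.1 x.1.2 x.2

lemma trW_torsion_isInvertedBy (S : Submonoid (End (𝟙_ T))) :
    (torsion S).trW.IsInvertedBy (centralMorphisms S).Q := by
  rintro a b f ⟨c, p, q, hT, s, hs, h⟩
  have inv : ∀ x : T, IsIso ((centralMorphisms S).Q.map (act s x)) := fun x =>
    Localization.inverts _ (centralMorphisms S) _
      (MorphismProperty.ofHoms.mk (⟨⟨s, hs⟩, x⟩ : S × T))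
  obtain ⟨g, hg⟩ : ∃ g : b ⟶ a, act s b = g ≫ f :=
    Triangle.coyoneda_exact₂ _ hT (act s b) (by
      change act s b ≫ p = 0
      rw [act_naturality, h, comp_zero])
  obtain ⟨k, hk⟩ : ∃ k : b ⟶ a, act s a = f ≫ k :=
    Triangle.yoneda_exact₂ _ (inv_rot_of_distTriang _ hT) (act s a) (by
      refine (act_naturality s _).symm.trans ?_
      change act s (c⟦(-1 : ℤ)⟧) ≫ _ = 0
      rw [act_shift_eq_zero s h]
      exact zero_comp)
  have hg' := (centralMorphisms S).Q.congr_map hg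
  have hk' := (centralMorphisms S).Q.congr_map hk
  simp only [Functor.map_comp] at hg' hk'
  have i1 := inv a
  have i2 := inv b
  have : IsSplitMono ((centralMorphisms S).Q.map f) :=
    ⟨⟨⟨(centralMorphisms S).Q.map k ≫ CategoryTheory.inv ((centralMorphisms S).Q.map (act s a)), by
      rw [← Category.assoc, ← hk', IsIso.hom_inv_id]⟩⟩⟩
  have : IsSplitEpi ((centralMorphisms S).Q.map f) :=
    ⟨⟨⟨CategoryTheory.inv ((centralMorphisms S).Q.map (act s b)) ≫ (centralMorphisms S).Q.map g, by
      rw [Category.assoc, ← hg', IsIso.inv_hom_id]⟩⟩⟩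
  exact isIso_of_epi_of_isSplitMono _

instance (S : Submonoid (End (𝟙_ T))) :
    (centralMorphisms S).Q.IsLocalization (torsion S).trW := by
  have key : ∀ (E : Type u) [Category.{max u v} E],
      Localization.StrictUniversalPropertyFixedTarget
        (centralMorphisms S).Q (torsion S).trW E := fun E _ =>
    { inverts := trW_torsion_isInvertedBy S
      lift := fun F hF => Localization.Construction.lift F
        (fun _ _ f hf => hF f (centralMorphisms_le_trW S _ hf))
      fac := fun F hF => Localization.Construction.fac F _
      uniq := fun F₁ F₂ h => Localization.Construction.uniq F₁ F₂ h }
  exact Functor.IsLocalization.mk' _ _ (key _) (key _)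

section

variable {T : Type u} [Category.{u} T] [HasZeroObject T] [HasShift T ℤ] [Preadditive T]
  [∀ n : ℤ, (shiftFunctor T n).Additive] [Pretriangulated T]
  [MonoidalCategory T] [SymmetricCategory T] [IsTensorTriangulated T] [IsTriangulated T]

/-- The central localization `S⁻¹T`. -/
abbrev CentralLocalization (S : Submonoid (End (𝟙_ T))) : Type u :=
  TTQuotient (centralMorphisms S).Q (torsion S)

/-- The localization functor `T ⥤ S⁻¹T`. -/
noncomputable abbrev toCentralLocalization (S : Submonoid (End (𝟙_ T))) : T ⥤ CentralLocalization S :=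
  toTTQuotient (centralMorphisms S).Q (torsion S)

/-- The Verdier quotient `T / I`. -/
abbrev VerdierQuotient (I : ObjectProperty T) [IsTTIdeal I] : Type u := TTQuotient I.trW.Q I

end
end CentralLocalization

section Spc

variable (T : Type u) [Category.{u} T] [HasZeroObject T] [HasShift T ℤ] [Preadditive T]
  [∀ n : ℤ, (shiftFunctor T n).Additive] [Pretriangulated T]
  [MonoidalCategory T] [SymmetricCategory T]

/-- The points of the spectrum: the prime ideals of `T`, i.e. the proper tt-ideals `P` such that
`a ⊗ b ∈ P` implies `a ∈ P` or `b ∈ P`. -/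
@[ext]
structure Spc where
  /-- The objects in the prime ideal. -/
  ideal : ObjectProperty T
  isTTIdeal : IsTTIdeal ideal
  proper : ∃ a, ¬ ideal a
  mem_or_mem : ∀ a b, ideal (a ⊗ b) → ideal a ∨ ideal b

attribute [instance] Spc.isTTIdeal

variable {T}

/-- The complement of the support of `a`. -/
def supportCompl (a : T) : Set (Spc T) := {P | P.ideal a}

/-- The complements `U(a)` of the supports form a base of open sets. -/
instance : TopologicalSpace (Spc T) := generateFrom (Set.range supportCompl)

lemma isOpen_supportCompl (a : T) : IsOpen (supportCompl a) := isOpen_generateFrom_of_mem ⟨a, rfl⟩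

lemma Spc.unit_notMem (P : Spc T) : ¬ P.ideal (𝟙_ T) := by
  intro h
  obtain ⟨a, ha⟩ := P.proper
  exact ha (P.ideal.prop_of_iso (ρ_ a) (IsTTIdeal.tensor_mem a _ h))

/-- The tt-ideal of the objects whose support does not meet `U`. -/
def idealOff (U : Set (Spc T)) : ObjectProperty T := fun a => ∀ P ∈ U, P.ideal a

lemma idealOff_anti {U V : Set (Spc T)} (h : V ⊆ U) : idealOff U ≤ idealOff V :=
  fun _ ha P hP => ha P (h hP)

lemma idealOff_le {U : Set (Spc T)} {P : Spc T} (h : P ∈ U) : idealOff U ≤ P.ideal :=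
  fun _ ha => ha P h

instance (U : Set (Spc T)) : IsTTIdeal (idealOff U) :=
  have : (idealOff U).IsStableUnderRetracts :=
    ⟨fun h ha P hP => P.ideal.prop_of_retract h (ha P hP)⟩
  have : (idealOff U).IsClosedUnderIsomorphisms :=
    ⟨fun e h => (idealOff U).prop_of_retract e.symm.retract h⟩
  have : (idealOff U).ContainsZero :=
    ⟨⟨HasZeroObject.zero' T |>.1, isZero_zero T, fun P _ =>
      P.ideal.prop_of_isZero (isZero_zero T)⟩⟩
  have : (idealOff U).IsStableUnderShift ℤ := ⟨fun n => ⟨fun _ h P hP =>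
    P.ideal.le_shift n _ (h P hP)⟩⟩
  have : (idealOff U).IsTriangulatedClosed₂ := .mk' (fun X hX h1 h3 P hP =>
    P.ideal.ext_of_isTriangulatedClosed₂ X hX (h1 P hP) (h3 P hP))
  { tensor_mem := fun _ _ h P hP => IsTTIdeal.tensor_mem _ _ (h P hP) }

end Spc

section Presheaf

variable {T : Type u} [Category.{u} T] [HasZeroObject T] [HasShift T ℤ] [Preadditive T]
  [∀ n : ℤ, (shiftFunctor T n).Additive] [Pretriangulated T]
  [MonoidalCategory T] [SymmetricCategory T] [IsTensorTriangulated T] [IsTriangulated T]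

/-- The quotient functor `T ⥤ T / I`. -/
noncomputable abbrev toVerdier (I : ObjectProperty T) [IsTTIdeal I] : T ⥤ VerdierQuotient I :=
  toTTQuotient I.trW.Q I

/-- The quotient functor preserves the unit. -/
noncomputable def verdierUnitIso (I : ObjectProperty T) [IsTTIdeal I] :
    (toVerdier I).obj (𝟙_ T) ≅ 𝟙_ (VerdierQuotient I) :=
  Iso.refl (I.trW.Q.obj (𝟙_ T))

lemma isIso_toVerdier_map (I : ObjectProperty T) [IsTTIdeal I] {a b : T} (f : a ⟶ b)
    (hf : I.trW f) : IsIso ((toVerdier I).map f) :=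
  Localization.inverts (toVerdier I) I.trW f hf

/-- The ring homomorphism on endomorphism rings of units induced by an additive functor that
preserves the unit. -/
def endUnitMap {C : Type u} [Category.{u} C] [Preadditive C] [MonoidalCategory C]
    {E : Type u} [Category.{u} E] [Preadditive E] [MonoidalCategory E]
    (G : C ⥤ E) [G.Additive] (e : G.obj (𝟙_ C) ≅ 𝟙_ E) : End (𝟙_ C) →+* End (𝟙_ E) where
  toFun f := e.inv ≫ G.map f ≫ e.hom
  map_one' := by
    change e.inv ≫ G.map (𝟙 _) ≫ e.hom = 𝟙 _
    simp
  map_mul' f g := by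
    change e.inv ≫ G.map (g ≫ f) ≫ e.hom =
      (e.inv ≫ G.map g ≫ e.hom) ≫ (e.inv ≫ G.map f ≫ e.hom)
    simp
  map_zero' := by
    rw [G.map_zero]
    simp
  map_add' f g := by
    rw [G.map_add]
    simp

/-- A functor `H` that inverts the morphisms with cone in `I` induces a ring homomorphism from
the endomorphism ring of the unit in `T / I` to the one of `H.obj (𝟙_ T) ≅ 𝟙_ E`. -/
noncomputable def liftRing (I : ObjectProperty T) [IsTTIdeal I]
    {E : Type u} [Category.{u} E] [Preadditive E] [MonoidalCategory E]
    (H : T ⥤ E) [H.Additive] (hH : I.trW.IsInvertedBy H) (e : H.obj (𝟙_ T) ≅ 𝟙_ E) :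
    End (𝟙_ (VerdierQuotient I)) →+* End (𝟙_ E) :=
  let G : VerdierQuotient I ⥤ E := Localization.Construction.lift H hH
  have hG : toVerdier I ⋙ G = H := Localization.Construction.fac H hH
  have : G.Additive := by
    rw [Localization.functor_additive_iff (toVerdier I) I.trW, hG]
    infer_instance
  endUnitMap G e

/-- The fraction `s⁻¹ φ` in the endomorphism ring of the unit in `T / I`. -/
noncomputable def frac (I : ObjectProperty T) [IsTTIdeal I] {y : T} (φ s : 𝟙_ T ⟶ y)
    (hs : I.trW s) : End (𝟙_ (VerdierQuotient I)) :=
  (MorphismProperty.LeftFraction.mk φ s hs).map (toVerdier I)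
    (Localization.inverts (toVerdier I) I.trW)

lemma exists_frac (I : ObjectProperty T) [IsTTIdeal I] (f : End (𝟙_ (VerdierQuotient I))) :
    ∃ (y : T) (φ s : 𝟙_ T ⟶ y) (hs : I.trW s), f = frac I φ s hs := by
  obtain ⟨z, hz⟩ := Localization.exists_leftFraction (toVerdier I) I.trW
    (X := 𝟙_ T) (Y := 𝟙_ T) f
  exact ⟨z.Y', z.f, z.s, z.hs, hz⟩

lemma liftRing_frac (I : ObjectProperty T) [IsTTIdeal I]
    {E : Type u} [Category.{u} E] [Preadditive E] [MonoidalCategory E]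
    (H : T ⥤ E) [H.Additive] (hH : I.trW.IsInvertedBy H) (e : H.obj (𝟙_ T) ≅ 𝟙_ E)
    {y : T} (φ s : 𝟙_ T ⟶ y) (hs : I.trW s) :
    liftRing I H hH e (frac I φ s hs) =
      e.inv ≫ (MorphismProperty.LeftFraction.mk φ s hs).map H hH ≫ e.hom := by
  let G : VerdierQuotient I ⥤ E := Localization.Construction.lift H hH
  have hs' := isIso_toVerdier_map I s hs
  have hs'' : IsIso (H.map s) := hH s hs
  change e.inv ≫ G.map ((toVerdier I).map φ ≫ inv ((toVerdier I).map s)) ≫ e.hom = _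
  have key : ∀ {a b : T} (f : a ⟶ b), G.map ((toVerdier I).map f) = H.map f := fun f =>
    (Functor.congr_hom (Localization.Construction.fac H hH) f).trans
      ((Category.id_comp _).trans (Category.comp_id _))
  have h1 : G.map ((toVerdier I).map φ) = H.map φ := key φ
  have h2 : G.map (inv ((toVerdier I).map s)) = inv (H.map s) := by
    rw [G.map_inv]
    simp only [key s]
    rfl
  rw [G.map_comp, h1, h2]
  rfl

lemma isInvertedBy_toVerdier {I J : ObjectProperty T} [IsTTIdeal I] [IsTTIdeal J] (h : I ≤ J) :
    I.trW.IsInvertedBy (toVerdier J) :=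
  fun _ _ f hf => isIso_toVerdier_map J f (ObjectProperty.trW_monotone h _ hf)

/-- Passing from `T / I` to `T / J` for `I ≤ J`. -/
noncomputable def resRing {I J : ObjectProperty T} [IsTTIdeal I] [IsTTIdeal J] (h : I ≤ J) :
    End (𝟙_ (VerdierQuotient I)) →+* End (𝟙_ (VerdierQuotient J)) :=
  liftRing I (toVerdier J) (isInvertedBy_toVerdier h) (verdierUnitIso J)

lemma resRing_frac {I J : ObjectProperty T} [IsTTIdeal I] [IsTTIdeal J] (h : I ≤ J)
    {y : T} (φ s : 𝟙_ T ⟶ y) (hs : I.trW s) :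
    resRing h (frac I φ s hs) = frac J φ s (ObjectProperty.trW_monotone h _ hs) := by
  refine (liftRing_frac I _ _ _ φ s hs).trans ?_
  exact (Category.id_comp _).trans (Category.comp_id _)

lemma resRing_refl {I : ObjectProperty T} [IsTTIdeal I] (h : I ≤ I) :
    resRing h = RingHom.id _ := by
  ext f
  obtain ⟨y, φ, s, hs, rfl⟩ := exists_frac I f
  rw [resRing_frac, RingHom.id_apply]

lemma resRing_comp {I J K : ObjectProperty T} [IsTTIdeal I] [IsTTIdeal J] [IsTTIdeal K]
    (h : I ≤ J) (h' : J ≤ K) (h'' : I ≤ K) :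
    (resRing h').comp (resRing h) = resRing h'' := by
  ext f
  obtain ⟨y, φ, s, hs, rfl⟩ := exists_frac I f
  rw [RingHom.comp_apply, resRing_frac, resRing_frac, resRing_frac]

variable (T) in
/-- The presheaf of rings `U ↦ End (𝟙)` with endomorphisms in `T / T_Z`, where `T_Z` consists of
the objects supported on the complement `Z` of `U`. -/
noncomputable def structurePresheaf : TopCat.Presheaf CommRingCat.{u} (TopCat.of (Spc T)) where
  obj U := CommRingCat.of (End (𝟙_ (VerdierQuotient (idealOff (U.unop : Set (Spc T))))))
  map {U V} i := CommRingCat.ofHom (resRing (idealOff_anti (leOfHom i.unop)))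
  map_id U := by
    rw [resRing_refl]
    rfl
  map_comp f g := by
    rw [← CommRingCat.ofHom_comp, resRing_comp]

end Presheaf

section Local

open scoped ZeroObject

variable {T : Type u} [Category.{u} T] [HasZeroObject T] [HasShift T ℤ] [Preadditive T]
  [∀ n : ℤ, (shiftFunctor T n).Additive] [Pretriangulated T]
  [MonoidalCategory T] [SymmetricCategory T] [IsTensorTriangulated T] [IsTriangulated T]

lemma toVerdier_isZero_iff (J : ObjectProperty T) [IsTTIdeal J] (c : T) :
    IsZero ((toVerdier J).obj c) ↔ J c := by
  refine ⟨fun h => ?_, fun h => ?_⟩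
  · have h0 : (toVerdier J).map (𝟙 c) = (toVerdier J).map (0 : c ⟶ c) := h.eq_of_src _ _
    obtain ⟨y, s, hs, hs'⟩ := (MorphismProperty.map_eq_iff_postcomp (toVerdier J) J.trW _ _).1 h0
    obtain rfl : s = 0 := by simpa using hs'
    obtain ⟨d, p, q, hT, hd⟩ := hs
    obtain ⟨r, hr⟩ : ∃ r : c⟦(1 : ℤ)⟧ ⟶ d, 𝟙 _ = r ≫ q :=
      Triangle.coyoneda_exact₁ _ hT (𝟙 _) (by
        change 𝟙 _ ≫ (0 : c ⟶ y)⟦(1 : ℤ)⟧' = 0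
        rw [Functor.map_zero, comp_zero])
    have : J (c⟦(1 : ℤ)⟧) := J.prop_of_retract ⟨r, q, hr.symm⟩ hd
    exact (J.prop_shift_iff_of_isStableUnderShift c (1 : ℤ)).1 this
  · have h1 : J.trW (0 : (0 : T) ⟶ c) := by
      refine (J.trW_iff _).2 ⟨c, 𝟙 c, 0, ?_, h⟩
      exact contractible_distinguished₁ c
    have := isIso_toVerdier_map J _ h1
    exact ((toVerdier J).map_isZero (isZero_zero T)).of_iso
      (asIso ((toVerdier J).map (0 : (0 : T) ⟶ c))).symm

lemma isIso_toVerdier_map_iff (J : ObjectProperty T) [IsTTIdeal J] {a b : T} (f : a ⟶ b) :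
    IsIso ((toVerdier J).map f) ↔ J.trW f := by
  refine ⟨fun h => ?_, isIso_toVerdier_map J f⟩
  obtain ⟨c, p, q, hT⟩ := distinguished_cocone_triangle f
  refine ⟨c, p, q, hT, ?_⟩
  refine (toVerdier_isZero_iff J c).1 ?_
  exact Triangle.isZero₃_of_isIso₁ _ ((toVerdier J).map_distinguished _ hT) h

lemma isUnit_frac_iff (J : ObjectProperty T) [IsTTIdeal J] {y : T} (φ s : 𝟙_ T ⟶ y)
    (hs : J.trW s) : IsUnit (frac J φ s hs) ↔ J.trW φ := by
  rw [← isIso_toVerdier_map_iff]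
  have hs' := isIso_toVerdier_map J s hs
  rw [isUnit_iff_isIso]
  change IsIso ((toVerdier J).map φ ≫ inv ((toVerdier J).map s)) ↔ _
  exact isIso_comp_right_iff _ _

lemma exists_cone_killed (f : End (𝟙_ T)) : ∃ (c : T) (p : 𝟙_ T ⟶ c) (q : c ⟶ (𝟙_ T)⟦(1 : ℤ)⟧)
    (_ : Triangle.mk (show 𝟙_ T ⟶ 𝟙_ T from f) p q ∈ distTriang T) (n : ℕ), act (f ^ n) c = 0 := by
  have h := act_mem_trW (Submonoid.powers f) f (Submonoid.mem_powers f) (𝟙_ T)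
  rw [act_unit] at h
  obtain ⟨c, p, q, hT, s, ⟨n, rfl⟩, h⟩ := h
  exact ⟨c, p, q, hT, n, h⟩

/-- If the tensor product of two nonzero objects is nonzero, then the central ring is local. -/
lemma isLocalRing_end_unit (h1 : ¬ IsZero (𝟙_ T))
    (h2 : ∀ a b : T, IsZero (a ⊗ b) → IsZero a ∨ IsZero b) : IsLocalRing (End (𝟙_ T)) := by
  have : Nontrivial (End (𝟙_ T)) := ⟨1, 0, fun h => h1 ((IsZero.iff_id_eq_zero _).2 h)⟩
  refine IsLocalRing.of_isUnit_or_isUnit_one_sub_self fun f => ?_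
  obtain ⟨c, p, q, hT, n, hn⟩ := exists_cone_killed f
  obtain ⟨d, p', q', hT', m, hm⟩ := exists_cone_killed (1 - f)
  have hcop : IsCoprime (f ^ n) ((1 - f) ^ m) :=
    IsCoprime.pow ⟨1, 1, by ring⟩
  obtain ⟨x, y, hxy⟩ := hcop
  have hz : IsZero (c ⊗ d) := by
    rw [IsZero.iff_id_eq_zero, ← act_one, ← hxy, act_add, act_mul, act_mul, act_tensor (f ^ n) c d,
      act_tensor' ((1 - f) ^ m) c d, hn, hm]
    simp
  refine (h2 c d hz).imp (fun h => ?_) (fun h => ?_)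
  · exact (isUnit_iff_isIso _).2 ((Triangle.isZero₃_iff_isIso₁ _ hT).1 h)
  · exact (isUnit_iff_isIso _).2 ((Triangle.isZero₃_iff_isIso₁ _ hT').1 h)

instance (P : Spc T) : IsLocalRing (End (𝟙_ (VerdierQuotient P.ideal))) := by
  refine isLocalRing_end_unit ?_ ?_
  · intro h
    exact P.unit_notMem ((toVerdier_isZero_iff P.ideal _).1 h)
  · intro a b h
    obtain ⟨x, ⟨i⟩⟩ : ∃ x, Nonempty ((toVerdier P.ideal).obj x ≅ a) :=
      ⟨_, ⟨(toVerdier P.ideal).objObjPreimageIso a⟩⟩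
    obtain ⟨y, ⟨j⟩⟩ : ∃ y, Nonempty ((toVerdier P.ideal).obj y ≅ b) :=
      ⟨_, ⟨(toVerdier P.ideal).objObjPreimageIso b⟩⟩
    have h' : IsZero ((toVerdier P.ideal).obj (x ⊗ y)) :=
      h.of_iso ((Functor.Monoidal.μIso (toVerdier P.ideal) x y).symm ≪≫ (i ⊗ᵢ j))
    refine (P.mem_or_mem x y ((toVerdier_isZero_iff P.ideal _).1 h')).imp (fun h => ?_)
      (fun h => ?_)
    · exact ((toVerdier_isZero_iff P.ideal _).2 h).of_iso i.symm
    · exact ((toVerdier_isZero_iff P.ideal _).2 h).of_iso j.symm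

end Local

section Desc

variable {X : TopCat.{u}} (F : X.Presheaf CommRingCat.{u}) (x : X) {Y : CommRingCat.{u}}
  (f : ∀ U : Opens X, x ∈ U → (F.obj (op U) ⟶ Y))
  (hf : ∀ (U V : Opens X) (i : V ⟶ U) (hx : x ∈ V), F.map i.op ≫ f V hx = f U (leOfHom i hx))

/-- A morphism out of a stalk. -/
noncomputable def descStalk : F.stalk x ⟶ Y :=
  colimit.desc ((OpenNhds.inclusion x).op ⋙ F)
    { pt := Y
      ι :=
        { app := fun U => f U.unop.1 U.unop.2
          naturality := fun U V i => (hf U.unop.1 V.unop.1 (homOfLE (leOfHom i.unop)) V.unop.2).trans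
            (Category.comp_id _).symm } }

lemma germ_descStalk (U : Opens X) (hx : x ∈ U) : F.germ U x hx ≫ descStalk F x f hf = f U hx :=
  colimit.ι_desc (F := (OpenNhds.inclusion x).op ⋙ F) _ (op ⟨U, hx⟩)

end Desc

section Stalks

variable (T : Type u) [Category.{u} T] [HasZeroObject T] [HasShift T ℤ] [Preadditive T]
  [∀ n : ℤ, (shiftFunctor T n).Additive] [Pretriangulated T]
  [MonoidalCategory T] [SymmetricCategory T] [IsTensorTriangulated T] [IsTriangulated T]

variable {T} in
/-- The section `s⁻¹ φ` of the structure presheaf over `U`. -/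
noncomputable def sec (U : Opens (TopCat.of (Spc T))) {y : T} (φ s : 𝟙_ T ⟶ y)
    (hs : (idealOff (U : Set (Spc T))).trW s) : (structurePresheaf T).obj (op U) :=
  frac _ φ s hs

/-- The morphism from the stalk of the structure presheaf at `P` to the endomorphism ring of the
unit in `T / P`. -/
noncomputable def stalkDesc (P : Spc T) :
    (structurePresheaf T).stalk (P : TopCat.of (Spc T)) ⟶
      CommRingCat.of (End (𝟙_ (VerdierQuotient P.ideal))) :=
  descStalk (structurePresheaf T) (P : TopCat.of (Spc T))
    (fun U hP => CommRingCat.ofHom (resRing (idealOff_le (U := (U : Set (Spc T))) hP)))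
    (fun _ _ _ _ => (CommRingCat.ofHom_comp _ _).symm.trans
      (congrArg CommRingCat.ofHom (resRing_comp _ _ _)))

variable {T}

lemma germ_stalkDesc (P : Spc T) (U : Opens (TopCat.of (Spc T))) (hP : P ∈ U) :
    (structurePresheaf T).germ U P hP ≫ stalkDesc T P =
      CommRingCat.ofHom (resRing (idealOff_le (U := (U : Set (Spc T))) hP)) :=
  germ_descStalk _ _ _ _ _ _

lemma stalkDesc_germ_sec (P : Spc T) (U : Opens (TopCat.of (Spc T))) (hP : P ∈ U) {y : T}
    (φ s : 𝟙_ T ⟶ y) (hs : (idealOff (U : Set (Spc T))).trW s) :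
    (stalkDesc T P).hom ((structurePresheaf T).germ U P hP (sec U φ s hs)) =
      frac P.ideal φ s (ObjectProperty.trW_monotone (idealOff_le hP) _ hs) :=
  (congrArg (fun k => k.hom (sec U φ s hs)) (germ_stalkDesc P U hP)).trans
    (resRing_frac (idealOff_le hP) φ s hs)

lemma res_sec {U V : Opens (TopCat.of (Spc T))} (i : V ⟶ U) {y : T}
    (φ s : 𝟙_ T ⟶ y) (hs : (idealOff (U : Set (Spc T))).trW s) :
    (structurePresheaf T).map i.op (sec U φ s hs) =
      sec V φ s (ObjectProperty.trW_monotone (idealOff_anti (leOfHom i)) _ hs) :=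
  resRing_frac (idealOff_anti (leOfHom i)) φ s hs

lemma exists_sec (U : Opens (TopCat.of (Spc T))) (f : (structurePresheaf T).obj (op U)) :
    ∃ (y : T) (φ s : 𝟙_ T ⟶ y) (hs : (idealOff (U : Set (Spc T))).trW s), f = sec U φ s hs :=
  exists_frac _ f

lemma isUnit_germ_sec_iff (P : Spc T) (U : Opens (TopCat.of (Spc T))) (hP : P ∈ U) {y : T}
    (φ s : 𝟙_ T ⟶ y) (hs : (idealOff (U : Set (Spc T))).trW s) :
    IsUnit ((structurePresheaf T).germ U P hP (sec U φ s hs)) ↔ P.ideal.trW φ := by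
  refine ⟨fun h => ?_, fun h => ?_⟩
  · have := h.map (stalkDesc T P).hom
    rwa [stalkDesc_germ_sec, isUnit_frac_iff] at this
  · obtain ⟨c, p, q, hT, hc⟩ := h
    let V : Opens (TopCat.of (Spc T)) := U ⊓ ⟨supportCompl c, isOpen_supportCompl c⟩
    let i : V ⟶ U := homOfLE inf_le_left
    have hV : P ∈ V := ⟨hP, hc⟩
    rw [← TopCat.Presheaf.germ_res_apply _ i P hV, res_sec]
    refine IsUnit.map ((structurePresheaf T).germ V P hV).hom ?_
    refine (isUnit_frac_iff _ φ s _).2 ⟨c, p, q, hT, fun Q hQ => hQ.2⟩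

instance isLocalHom_stalkDesc (P : Spc T) : IsLocalHom (stalkDesc T P).hom := by
  refine ⟨fun x hx => ?_⟩
  obtain ⟨U, hP, f, rfl⟩ := TopCat.Presheaf.exists_germ_eq _ x
  obtain ⟨y, φ, s, hs, rfl⟩ := exists_sec U f
  rw [stalkDesc_germ_sec, isUnit_frac_iff] at hx
  rwa [isUnit_germ_sec_iff]

instance isLocalRing_stalk_structurePresheaf (P : Spc T) :
    IsLocalRing ((structurePresheaf T).stalk (P : TopCat.of (Spc T))) :=
  (stalkDesc T P).hom.domain_isLocalRing

variable (T)

/-- The structure sheaf: the sheafification of the structure presheaf. -/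
noncomputable def structureSheaf : TopCat.Sheaf CommRingCat.{u} (TopCat.of (Spc T)) :=
  (presheafToSheaf (Opens.grothendieckTopology (TopCat.of (Spc T))) CommRingCat.{u}).obj
    (structurePresheaf T)

/-- The canonical morphism from the structure presheaf to the structure sheaf. -/
noncomputable def toStructureSheaf : structurePresheaf T ⟶ (structureSheaf T).obj :=
  toSheafify (Opens.grothendieckTopology (TopCat.of (Spc T))) (structurePresheaf T)

instance (P : TopCat.of (Spc T)) : IsIso ((TopCat.Presheaf.stalkFunctor CommRingCat.{u} P).map
    (toStructureSheaf T)) :=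
  TopCat.Presheaf.stalkFunctor_map_unit_toSheafify_isIso P CommRingCat.{u} (structurePresheaf T)

/-- The spectrum of `T`, as a locally ringed space. -/
noncomputable def Spec : AlgebraicGeometry.LocallyRingedSpace.{u} where
  carrier := TopCat.of (Spc T)
  presheaf := (structureSheaf T).obj
  IsSheaf := (structureSheaf T).property
  isLocalRing P := by
    let e := (asIso ((TopCat.Presheaf.stalkFunctor CommRingCat.{u} P).map
      (toStructureSheaf T))).commRingCatIsoToRingEquiv
    have : IsLocalRing ((TopCat.Presheaf.stalkFunctor CommRingCat.{u} P).obj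
      (structurePresheaf T)) := isLocalRing_stalk_structurePresheaf P
    exact e.isLocalRing

end Stalks

section Functoriality

variable {T : Type u} [Category.{u} T] [HasZeroObject T] [HasShift T ℤ] [Preadditive T]
  [∀ n : ℤ, (shiftFunctor T n).Additive] [Pretriangulated T]
  [MonoidalCategory T] [SymmetricCategory T]
  {T' : Type u} [Category.{u} T'] [HasZeroObject T'] [HasShift T' ℤ] [Preadditive T']
  [∀ n : ℤ, (shiftFunctor T' n).Additive] [Pretriangulated T']
  [MonoidalCategory T'] [SymmetricCategory T']
  (F : T ⥤ T') [F.Monoidal] [F.CommShift ℤ] [F.IsTriangulated]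

instance (J : ObjectProperty T') [IsTTIdeal J] : IsTTIdeal (J.inverseImage F) :=
  have : (J.inverseImage F).IsStableUnderRetracts :=
    ⟨fun h ha => J.prop_of_retract (h.map F) ha⟩
  { tensor_mem := fun a b hb =>
      J.prop_of_iso (Functor.Monoidal.μIso F a b) (IsTTIdeal.tensor_mem (F.obj a) (F.obj b) hb) }

/-- The preimage of a prime under a tensor triangulated functor. -/
def Spc.comap (P : Spc T') : Spc T where
  ideal := P.ideal.inverseImage F
  isTTIdeal := inferInstance
  proper := ⟨𝟙_ T, fun h => P.unit_notMem
    (P.ideal.prop_of_iso (Functor.Monoidal.εIso F).symm h)⟩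
  mem_or_mem a b h := P.mem_or_mem _ _
    (P.ideal.prop_of_iso (Functor.Monoidal.μIso F a b).symm h)

lemma Spc.continuous_comap : Continuous (Spc.comap F) := by
  refine continuous_generateFrom_iff.2 ?_
  rintro _ ⟨a, rfl⟩
  exact isOpen_supportCompl (F.obj a)

variable [IsTensorTriangulated T] [IsTriangulated T] [IsTensorTriangulated T'] [IsTriangulated T']

open Functor.LaxMonoidal in
lemma trW_ε_comp {I : ObjectProperty T} {J : ObjectProperty T'} [IsTTIdeal I] [IsTTIdeal J]
    (h : I ≤ J.inverseImage F) {y : T} (s : 𝟙_ T ⟶ y) (hs : I.trW s) :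
    J.trW (ε F ≫ F.map s) :=
  (MorphismProperty.cancel_left_of_respectsIso _ _ _).2
    ((J.inverseImage_trW_iff F s).1 (ObjectProperty.trW_monotone h _ hs))

/-- The ring homomorphism from the endomorphism ring of the unit in `T / I` to the one in `T' / J`
induced by a tensor triangulated functor `F : T ⥤ T'` with `F(I) ⊆ J`. -/
noncomputable def mapRing {I : ObjectProperty T} {J : ObjectProperty T'} [IsTTIdeal I]
    [IsTTIdeal J] (h : I ≤ J.inverseImage F) :
    End (𝟙_ (VerdierQuotient I)) →+* End (𝟙_ (VerdierQuotient J)) :=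
  haveI : F.Additive := inferInstance
  liftRing I (F ⋙ toVerdier J)
    (fun _ _ s hs => isIso_toVerdier_map J _
      ((J.inverseImage_trW_iff F s).1 (ObjectProperty.trW_monotone h _ hs)))
    ((toVerdier J).mapIso (Functor.Monoidal.εIso F).symm ≪≫ verdierUnitIso J)

open Functor.LaxMonoidal in
lemma mapRing_frac {I : ObjectProperty T} {J : ObjectProperty T'} [IsTTIdeal I]
    [IsTTIdeal J] (h : I ≤ J.inverseImage F) {y : T} (φ s : 𝟙_ T ⟶ y) (hs : I.trW s) :
    mapRing F h (frac I φ s hs) =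
      frac J (ε F ≫ F.map φ) (ε F ≫ F.map s) (trW_ε_comp F h s hs) := by
  refine (liftRing_frac I _ _ _ φ s hs).trans ?_
  have h1 := isIso_toVerdier_map J _ ((J.inverseImage_trW_iff F s).1 (ObjectProperty.trW_monotone h _ hs))
  have h2 := isIso_toVerdier_map J _ (trW_ε_comp F h s hs)
  change (𝟙 _ ≫ (toVerdier J).map (ε F)) ≫
    ((toVerdier J).map (F.map φ) ≫ inv ((toVerdier J).map (F.map s))) ≫
    ((toVerdier J).map (Functor.OplaxMonoidal.η F) ≫ 𝟙 _) =
    (toVerdier J).map (ε F ≫ F.map φ) ≫ inv ((toVerdier J).map (ε F ≫ F.map s))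
  have h3 : inv ((toVerdier J).map (ε F ≫ F.map s)) =
      inv ((toVerdier J).map (F.map s)) ≫ (toVerdier J).map (Functor.OplaxMonoidal.η F) := by
    rw [IsIso.inv_eq_of_hom_inv_id]
    rw [Functor.map_comp, Category.assoc, IsIso.hom_inv_id_assoc, ← Functor.map_comp,
      Functor.Monoidal.ε_η, CategoryTheory.Functor.map_id]
  rw [h3, Functor.map_comp]
  simp only [Category.assoc, Category.id_comp]
  congr 3

lemma mapRing_comp_resRing {I I' : ObjectProperty T} {J J' : ObjectProperty T'} [IsTTIdeal I]
    [IsTTIdeal J] [IsTTIdeal I'] [IsTTIdeal J'] (h : I ≤ J.inverseImage F) (h₁ : I ≤ I')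
    (h₂ : J ≤ J') (h' : I' ≤ J'.inverseImage F) :
    (mapRing F h').comp (resRing h₁) = (resRing h₂).comp (mapRing F h) := by
  ext f
  obtain ⟨y, φ, s, hs, rfl⟩ := exists_frac I f
  rw [RingHom.comp_apply, RingHom.comp_apply, resRing_frac, mapRing_frac, mapRing_frac,
    resRing_frac]

lemma idealOff_le_inverseImage {U : Set (Spc T)} :
    idealOff U ≤ (idealOff (Spc.comap F ⁻¹' U)).inverseImage F :=
  fun _ ha _ hP => ha _ hP

/-- The continuous map on spectra induced by a tensor triangulated functor. -/
def Spc.comapHom : TopCat.of (Spc T') ⟶ TopCat.of (Spc T) :=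
  TopCat.ofHom ⟨Spc.comap F, Spc.continuous_comap F⟩

/-- The morphism of structure presheaves induced by a tensor triangulated functor. -/
noncomputable def structurePresheafMap :
    structurePresheaf T ⟶ (TopCat.Presheaf.pushforward CommRingCat.{u} (Spc.comapHom F)).obj
      (structurePresheaf T') where
  app U := CommRingCat.ofHom (mapRing F (idealOff_le_inverseImage F (U := (U.unop : Set (Spc T)))))
  naturality U V i := by
    refine (CommRingCat.ofHom_comp _ _).symm.trans
      ((congrArg CommRingCat.ofHom ?_).trans (CommRingCat.ofHom_comp _ _))
    exact mapRing_comp_resRing F _ _ _ _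

/-- The morphism of structure sheaves induced by a tensor triangulated functor. -/
noncomputable def structureSheafMap :
    (structureSheaf T).obj ⟶ (TopCat.Presheaf.pushforward CommRingCat.{u} (Spc.comapHom F)).obj
      (structureSheaf T').obj :=
  sheafifyLift (Opens.grothendieckTopology (TopCat.of (Spc T)))
    (structurePresheafMap F ≫ (TopCat.Presheaf.pushforward CommRingCat.{u} (Spc.comapHom F)).map
      (toStructureSheaf T'))
    (TopCat.Sheaf.pushforward_sheaf_of_sheaf (Spc.comapHom F) (structureSheaf T').property)

lemma toStructureSheaf_map :
    toStructureSheaf T ≫ structureSheafMap F = structurePresheafMap F ≫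
      (TopCat.Presheaf.pushforward CommRingCat.{u} (Spc.comapHom F)).map (toStructureSheaf T') :=
  toSheafify_sheafifyLift _ _ _

open Functor.LaxMonoidal in
lemma structurePresheafMap_sec (U : Opens (TopCat.of (Spc T))) {y : T} (φ s : 𝟙_ T ⟶ y)
    (hs : (idealOff (U : Set (Spc T))).trW s) :
    (structurePresheafMap F).app (op U) (sec U φ s hs) =
      sec ((Opens.map (Spc.comapHom F)).obj U) (ε F ≫ F.map φ) (ε F ≫ F.map s)
        (trW_ε_comp F (idealOff_le_inverseImage F) s hs) :=
  mapRing_frac F (idealOff_le_inverseImage F) φ s hs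

lemma isUnit_germ_toStructureSheaf_iff (P : Spc T) (U : Opens (TopCat.of (Spc T))) (hP : P ∈ U)
    {y : T} (φ s : 𝟙_ T ⟶ y) (hs : (idealOff (U : Set (Spc T))).trW s) :
    IsUnit ((structureSheaf T).presheaf.germ U P hP ((toStructureSheaf T).app (op U) (sec U φ s hs))) ↔
      P.ideal.trW φ := by
  rw [← isUnit_germ_sec_iff P U hP φ s hs]
  have h := TopCat.Presheaf.stalkFunctor_map_germ_apply U P hP (toStructureSheaf T) (sec U φ s hs)
  rw [← h]
  exact isUnit_map_iff ((TopCat.Presheaf.stalkFunctor CommRingCat.{u} (P : TopCat.of (Spc T))).map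
      (toStructureSheaf T)).hom _

lemma exists_germ_toStructureSheaf (P : Spc T)
    (x : (structureSheaf T).presheaf.stalk (P : TopCat.of (Spc T))) :
    ∃ (U : Opens (TopCat.of (Spc T))) (hP : P ∈ U) (y : T) (φ s : 𝟙_ T ⟶ y)
      (hs : (idealOff (U : Set (Spc T))).trW s),
      x = (structureSheaf T).presheaf.germ U P hP ((toStructureSheaf T).app (op U) (sec U φ s hs)) := by
  let e := (asIso ((TopCat.Presheaf.stalkFunctor CommRingCat.{u} (P : TopCat.of (Spc T))).map
      (toStructureSheaf T))).commRingCatIsoToRingEquiv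
  obtain ⟨x, rfl⟩ := e.surjective x
  obtain ⟨U, hP, f, rfl⟩ := TopCat.Presheaf.exists_germ_eq _ x
  obtain ⟨y, φ, s, hs, rfl⟩ := exists_sec U f
  exact ⟨U, hP, y, φ, s, hs,
    TopCat.Presheaf.stalkFunctor_map_germ_apply U P hP (toStructureSheaf T) (sec U φ s hs)⟩

lemma toStructureSheaf_map_app (U : Opens (TopCat.of (Spc T)))
    (f : (structurePresheaf T).obj (op U)) :
    (structureSheafMap F).app (op U) ((toStructureSheaf T).app (op U) f) =
      (toStructureSheaf T').app (op ((Opens.map (Spc.comapHom F)).obj U))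
        ((structurePresheafMap F).app (op U) f) :=
  congrArg (fun k => k.hom f) (congr_app (toStructureSheaf_map F) (op U))

/-- The morphism of spectra induced by a tensor triangulated functor. -/
noncomputable def Spec.map : Spec T' ⟶ Spec T where
  base := Spc.comapHom F
  c := structureSheafMap F
  prop P := by
    refine ⟨fun x hx => ?_⟩
    obtain ⟨U, hP, y, φ, s, hs, rfl⟩ := exists_germ_toStructureSheaf (Spc.comap F P) x
    have h1 := AlgebraicGeometry.PresheafedSpace.stalkMap_germ_apply
      (X := (Spec T').toPresheafedSpace) (Y := (Spec T).toPresheafedSpace)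
      ⟨Spc.comapHom F, structureSheafMap F⟩ U P hP ((toStructureSheaf T).app (op U) (sec U φ s hs))
    have h2 := (congrArg IsUnit h1).mp hx
    have h3 := (toStructureSheaf_map_app F U (sec U φ s hs)).trans
      (congrArg _ (structurePresheafMap_sec F U φ s hs))
    have h4 := (congrArg (fun t => IsUnit ((structureSheaf T').presheaf.germ
      ((Opens.map (Spc.comapHom F)).obj U) P hP t)) h3).mp h2
    have h5 := (isUnit_germ_toStructureSheaf_iff P ((Opens.map (Spc.comapHom F)).obj U) hP
      _ _ (trW_ε_comp F (idealOff_le_inverseImage F) s hs)).1 h4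
    refine (isUnit_germ_toStructureSheaf_iff (Spc.comap F P) U hP φ s hs).2 ?_
    let J : ObjectProperty T' := Spc.ideal P
    have : IsTTIdeal J := Spc.isTTIdeal P
    refine (J.inverseImage_trW_iff F φ).2 ?_
    exact (MorphismProperty.cancel_left_of_respectsIso _ _ _).1 h5

end Functoriality

section Comparison

variable (T : Type u) [Category.{u} T] [HasZeroObject T] [HasShift T ℤ] [Preadditive T]
  [∀ n : ℤ, (shiftFunctor T n).Additive] [Pretriangulated T]
  [MonoidalCategory T] [SymmetricCategory T] [IsTensorTriangulated T] [IsTriangulated T]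

/-- The canonical ring homomorphism from the central ring of `T` to the global sections of the
structure sheaf. -/
noncomputable def toGlobalSections :
    CommRingCat.of (End (𝟙_ T)) ⟶ AlgebraicGeometry.LocallyRingedSpace.Γ.obj (op (Spec T)) :=
  CommRingCat.ofHom (endUnitMap (toVerdier (idealOff ((⊤ : Opens (TopCat.of (Spc T))) :
    Set (Spc T)))) (verdierUnitIso _)) ≫ (toStructureSheaf T).app (op ⊤)

/-- The comparison morphism from the spectrum of `T` to the spectrum of the central ring of `T`:
the morphism that corresponds to `toGlobalSections T` under the adjunction between global sections
and prime spectra. -/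
noncomputable def rho : Spec T ⟶
    AlgebraicGeometry.Spec.toLocallyRingedSpace.{u}.obj (op (CommRingCat.of (End (𝟙_ T)))) :=
  AlgebraicGeometry.ΓSpec.locallyRingedSpaceAdjunction.homEquiv (Spec T)
    (op (CommRingCat.of (End (𝟙_ T)))) (toGlobalSections T).op

variable {T}

lemma endUnitMap_toVerdier (I : ObjectProperty T) [IsTTIdeal I] (r : End (𝟙_ T)) :
    endUnitMap (toVerdier I) (verdierUnitIso I) r =
      frac I r (𝟙 _) (I.trW_of_isIso (𝟙 _)) := by
  have := isIso_toVerdier_map I _ (I.trW_of_isIso (𝟙 (𝟙_ T)))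
  change 𝟙 _ ≫ (toVerdier I).map r ≫ 𝟙 _ = (toVerdier I).map r ≫ inv ((toVerdier I).map (𝟙 (𝟙_ T)))
  have h : inv ((toVerdier I).map (𝟙 (𝟙_ T))) = 𝟙 _ := by
    rw [IsIso.inv_eq_of_hom_inv_id]
    rw [CategoryTheory.Functor.map_id, Category.comp_id]
  rw [h]
  exact Category.id_comp _

/-- The image of a prime `P` under the comparison map consists of the elements of the central ring
whose cone does not lie in `P`. -/
theorem mem_rho_iff (P : Spc T) (r : End (𝟙_ T)) :
    r ∈ PrimeSpectrum.asIdeal ((rho T).base P) ↔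
      ∀ (c : T) (p : 𝟙_ T ⟶ c) (q : c ⟶ (𝟙_ T)⟦(1 : ℤ)⟧),
        Triangle.mk (show 𝟙_ T ⟶ 𝟙_ T from r) p q ∈ (distTriang T) → ¬ P.ideal c := by
  have h1 : r ∉ PrimeSpectrum.asIdeal ((rho T).base P) ↔ P.ideal.trW r := by
    rw [← isUnit_germ_toStructureSheaf_iff P ⊤ trivial r (𝟙 _) (ObjectProperty.trW_of_isIso _ _)]
    refine (AlgebraicGeometry.LocallyRingedSpace.notMem_prime_iff_unit_in_stalk (Spec T)
      (toGlobalSections T r) P).trans ?_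
    refine iff_of_eq (congrArg IsUnit ?_)
    refine congrArg ((structureSheaf T).presheaf.germ ⊤ P trivial) ?_
    exact congrArg ((toStructureSheaf T).app (op ⊤)) (endUnitMap_toVerdier _ r)
  rw [← not_iff_not, h1, ObjectProperty.trW_iff]
  push Not
  simp only [exists_prop]

end Comparison

section Rigid

variable {T : Type u} [Category.{u} T] [HasZeroObject T] [HasShift T ℤ] [Preadditive T]
  [∀ n : ℤ, (shiftFunctor T n).Additive] [Pretriangulated T]
  [MonoidalCategory T] [SymmetricCategory T]

/-- The property `z ↦ b ⊗ z ∈ J`. -/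
def colon (J : ObjectProperty T) (b : T) : ObjectProperty T := fun z => J (b ⊗ z)

instance [IsTensorTriangulated T] (J : ObjectProperty T) [IsTTIdeal J] (b : T) :
    IsTTIdeal (colon J b) := by
  obtain ⟨σ, -, -, hσ⟩ := IsTensorTriangulated.exact_tensor (T := T)
  have hr : (colon J b).IsStableUnderRetracts :=
    ⟨fun h ha => J.prop_of_retract (h.map (tensorLeft b)) ha⟩
  have hi : (colon J b).IsClosedUnderIsomorphisms :=
    ⟨fun e h => (colon J b).prop_of_retract e.symm.retract h⟩
  have h0 : (colon J b).ContainsZero :=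
    ⟨⟨HasZeroObject.zero' T |>.1, isZero_zero T, J.prop_of_isZero
      ((tensorLeft b).map_isZero (isZero_zero T))⟩⟩
  have shift1 : ∀ z : T, colon J b z ↔ colon J b (z⟦(1 : ℤ)⟧) := fun z =>
    (J.prop_shift_iff_of_isStableUnderShift (b ⊗ z) (1 : ℤ)).symm.trans
      (J.prop_iff_of_iso (σ b z).symm)
  have shiftn : ∀ (n : ℤ) (z : T), colon J b z → colon J b (z⟦n⟧) := by
    intro n
    induction n using Int.induction_on with
    | zero => exact fun z h => (colon J b).prop_of_iso ((shiftFunctorZero T ℤ).app z).symm h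
    | succ n ih =>
      exact fun z h => (colon J b).prop_of_iso ((shiftFunctorAdd T (n : ℤ) 1).app z).symm
        ((shift1 _).1 (ih z h))
    | pred n ih =>
      intro z h
      rw [shift1]
      exact (colon J b).prop_of_iso
        ((shiftFunctorAdd' T (-(n : ℤ) - 1) 1 (-(n : ℤ)) (by ring)).app z) (ih z h)
  have hs : (colon J b).IsStableUnderShift ℤ := ⟨fun n => ⟨fun z h => shiftn n z h⟩⟩
  have h2 : (colon J b).IsTriangulatedClosed₂ := .mk' (fun X hX h1 h3 =>
    J.ext_of_isTriangulatedClosed₂ _ (hσ b X hX) h1 h3)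
  exact { tensor_mem := fun x z h => J.prop_of_iso
            ((α_ x b z).symm ≪≫ whiskerRightIso (β_ x b) z ≪≫ α_ b x z)
            (IsTTIdeal.tensor_mem x (b ⊗ z) h) }

/-- The union of a nonempty chain of tt-ideals. -/
lemma isTTIdeal_sSup (c : Set (ObjectProperty T)) (hc : IsChain (· ≤ ·) c) (hne : c.Nonempty)
    (h : ∀ J ∈ c, IsTTIdeal J) : IsTTIdeal (fun z => ∃ J ∈ c, J z : ObjectProperty T) := by
  let K : ObjectProperty T := fun z => ∃ J ∈ c, J z
  change IsTTIdeal K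
  have hr : K.IsStableUnderRetracts := ⟨by
    rintro _ _ r ⟨J, hJ, hz⟩
    have := h J hJ
    exact ⟨J, hJ, J.prop_of_retract r hz⟩⟩
  have hi : K.IsClosedUnderIsomorphisms := ⟨fun e h => K.prop_of_retract e.symm.retract h⟩
  have h0 : K.ContainsZero := by
    obtain ⟨J, hJ⟩ := hne
    have := h J hJ
    exact ⟨⟨HasZeroObject.zero' T |>.1, isZero_zero T, J, hJ, J.prop_of_isZero (isZero_zero T)⟩⟩
  have hs : K.IsStableUnderShift ℤ := ⟨fun n => ⟨by
    rintro z ⟨J, hJ, hz⟩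
    have := h J hJ
    exact ⟨J, hJ, J.le_shift n z hz⟩⟩⟩
  have h2 : K.IsTriangulatedClosed₂ := .mk' (by
    rintro X hX ⟨J₁, hJ₁, h1⟩ ⟨J₃, hJ₃, h3⟩
    have i1 := h J₁ hJ₁
    have i3 := h J₃ hJ₃
    obtain hle | hle := hc.total hJ₁ hJ₃
    · exact ⟨J₃, hJ₃, J₃.ext_of_isTriangulatedClosed₂ X hX (hle _ h1) h3⟩
    · exact ⟨J₁, hJ₁, J₁.ext_of_isTriangulatedClosed₂ X hX h1 (hle _ h3)⟩)
  exact { tensor_mem := by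
            rintro x z ⟨J, hJ, hz⟩
            have := h J hJ
            exact ⟨J, hJ, IsTTIdeal.tensor_mem x z hz⟩ }

/-- In a rigid tt-category, `idealOff (supportCompl a)` is the tt-ideal generated by `a`. -/
theorem idealOff_supportCompl_iff [IsTensorTriangulated T] [RigidCategory T] (a b : T) :
    idealOff (supportCompl a) b ↔ ∀ I : ObjectProperty T, IsTTIdeal I → I a → I b := by
  refine ⟨fun hb I hI ha => ?_, fun hb P ha => hb P.ideal P.isTTIdeal ha⟩
  by_contra hIb
  obtain ⟨J, hIJ, hJ⟩ := zorn_le_nonempty₀ {J : ObjectProperty T | IsTTIdeal J ∧ ¬ J b}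
    (fun c hc hch K hK => ⟨fun z => ∃ J ∈ c, J z,
      ⟨isTTIdeal_sSup c hch ⟨K, hK⟩ (fun J hJ => (hc hJ).1), fun ⟨J, hJ, hz⟩ => (hc hJ).2 hz⟩,
      fun J hJ z hz => ⟨J, hJ, hz⟩⟩) I ⟨hI, hIb⟩
  obtain ⟨hJ', hJb⟩ := hJ.prop
  have key : ∀ x z : T, ¬ J z → J (x ⊗ z) → J (x ⊗ b) := by
    intro x z hz hxz
    by_contra hxb
    exact hz (hJ.le_of_ge (y := colon J x) ⟨inferInstance, hxb⟩
      (fun w hw => IsTTIdeal.tensor_mem x w hw) z hxz)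
  let P : Spc T :=
    { ideal := J
      isTTIdeal := hJ'
      proper := ⟨b, hJb⟩
      mem_or_mem := by
        intro x y hxy
        by_contra! hcon
        have h1 : J (x ⊗ b) := key x y hcon.2 hxy
        have h2 : J (b ⊗ b) := key b x hcon.1 (J.prop_of_iso (β_ x b) h1)
        have h3 : J (b ⊗ (bᘁ ⊗ b)) := J.prop_of_iso
          ((α_ bᘁ b b).symm ≪≫ whiskerRightIso (β_ bᘁ b) b ≪≫ α_ b bᘁ b)
          (IsTTIdeal.tensor_mem bᘁ (b ⊗ b) h2)
        refine hJb (J.prop_of_retract (Y := b ⊗ (bᘁ ⊗ b))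
          ⟨(λ_ b).inv ≫ (η_ b bᘁ) ▷ b ≫ (α_ b bᘁ b).hom, b ◁ (ε_ b bᘁ) ≫ (ρ_ b).hom, ?_⟩ h3)
        simp only [Category.assoc]
        rw [ExactPairing.evaluation_coevaluation_assoc]
        simp }
  exact hJb (hb P (hIJ a ha))

end Rigid

section CentralMap

variable {T : Type u} [Category.{u} T] [HasZeroObject T] [HasShift T ℤ] [Preadditive T]
  [∀ n : ℤ, (shiftFunctor T n).Additive] [Pretriangulated T]
  [MonoidalCategory T] [SymmetricCategory T] [IsTensorTriangulated T] [IsTriangulated T]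

/-- The ring homomorphism from the central ring of `T` to the central ring of `S⁻¹T` induced by the
localization functor. -/
noncomputable def centralMap (S : Submonoid (End (𝟙_ T))) :
    End (𝟙_ T) →+* End (𝟙_ (CentralLocalization S)) :=
  endUnitMap (toCentralLocalization S) (Functor.Monoidal.εIso (toCentralLocalization S)).symm

/-- The continuous map on spectra induced by the localization functor. -/
noncomputable abbrev locBase (S : Submonoid (End (𝟙_ T))) :
    TopCat.of (Spc (CentralLocalization S)) ⟶ TopCat.of (Spc T) :=
  Spc.comapHom (toCentralLocalization S)

/-- The comparison map from the inverse image of the structure sheaf of the spectrum of `T` to the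
structure sheaf of the spectrum of `S⁻¹T`. -/
noncomputable def pullbackStructureSheafMap (S : Submonoid (End (𝟙_ T))) :
    (TopCat.Sheaf.pullback CommRingCat.{u} (locBase S)).obj (structureSheaf T) ⟶
      structureSheaf (CentralLocalization S) :=
  ((TopCat.Sheaf.pullbackPushforwardAdjunction CommRingCat.{u} (locBase S)).homEquiv
    (structureSheaf T) (structureSheaf (CentralLocalization S))).symm
    ⟨structureSheafMap (toCentralLocalization S)⟩

end CentralMap

end TTGeometry

/-! By `instIsLocalization`-type bookkeeping in the definitions, `S⁻¹T` is the Verdier quotient of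
`T` by the tt-ideal `torsion S` of objects killed by some `s ∈ S`. Apart from the central ring and
the description of the image, everything is a statement about a quotient `Q : T ⥤ T/I` by a
tt-ideal.

Central ring: an endomorphism of the unit of `S⁻¹T` is a fraction whose denominator is any morphism
`𝟙 ⟶ y` with torsion cone. Since the cone is killed by some `s ∈ S`, the denominator divides `s`
(`exists_comp_eq_act`), so it can be replaced by an element of `S`. The same argument turns equality
in `S⁻¹T` into equality after multiplication by an element of `S`.

Points: primes of `T/I` correspond to primes of `T` containing `I`, and the topologies agree because
every object of `T/I` is isomorphic to some `Q a`. For `I = torsion S`, containing `I` means that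
every `s ∈ S` becomes invertible in `T/P`, i.e. that `ρ(P)` misses `S`.

Sheaf: the stalk of the structure sheaf at `P` is `End(𝟙)` in `T/P` (`bijective_stalkDesc`), and
`(T/I)/J` is `T/Q⁻¹J` (`isLocalization_comp_toVerdier`). Hence `Spec(Q)` is an isomorphism on
stalks, which gives the isomorphism from the inverse image sheaf.

Square: a topological embedding that is an isomorphism on stalks is a monomorphism through which
every morphism with image in its range factors. The bottom arrow is a monomorphism because
localization of rings is an epimorphism. So cartesianness reduces to commutativity, which is
naturality of `ρ`, and to the equality of point sets found above (`isPullback_of_isEmbedding`). -/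

namespace TTGeometry

/-! ### The central ring of `S⁻¹T`. -/

section CentralLocalization

variable {T : Type u} [Category.{u} T] [HasZeroObject T] [HasShift T ℤ] [Preadditive T]
  [∀ n : ℤ, (shiftFunctor T n).Additive] [Pretriangulated T]
  [MonoidalCategory T] [SymmetricCategory T] [IsTensorTriangulated T] [IsTriangulated T]

/-- A morphism with torsion cone divides the action of some element of `S`. -/
lemma exists_comp_eq_act (S : Submonoid (End (𝟙_ T))) {a b : T} (f : a ⟶ b)
    (hf : (torsion S).trW f) : ∃ s ∈ S, ∃ k : b ⟶ a, f ≫ k = act s a := by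
  obtain ⟨c, p, q, hT, s, hs, h⟩ := hf
  -- In the triangle `c⟦-1⟧ ⟶ a ⟶ b ⟶ c`, the action of `s` on `a` vanishes after precomposition
  -- with `c⟦-1⟧ ⟶ a`, because by naturality it can be moved to `c⟦-1⟧`, which `s` kills. Hence it
  -- factors through `f`.
  obtain ⟨k, hk⟩ : ∃ k : b ⟶ a, act s a = f ≫ k :=
    Triangle.yoneda_exact₂ _ (inv_rot_of_distTriang _ hT) (act s a) (by
      refine (act_naturality s _).symm.trans ?_
      change act s (c⟦(-1 : ℤ)⟧) ≫ _ = 0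
      rw [act_shift_eq_zero s h]
      exact zero_comp)
  exact ⟨s, hs, k, hk.symm⟩

lemma isIso_toCentralLocalization_map (S : Submonoid (End (𝟙_ T))) {a b : T} (f : a ⟶ b)
    (hf : (torsion S).trW f) : IsIso ((toCentralLocalization S).map f) :=
  Localization.inverts (toCentralLocalization S) (torsion S).trW f hf

lemma trW_of_mem (S : Submonoid (End (𝟙_ T))) {s : End (𝟙_ T)} (hs : s ∈ S) :
    (torsion S).trW (show 𝟙_ T ⟶ 𝟙_ T from s) := by
  have h := act_mem_trW S s hs (𝟙_ T)
  rwa [act_unit] at h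

lemma isUnit_centralMap (S : Submonoid (End (𝟙_ T))) {s : End (𝟙_ T)} (hs : s ∈ S) :
    IsUnit (centralMap S s) := by
  have := isIso_toCentralLocalization_map S _ (trW_of_mem S hs)
  rw [isUnit_iff_isIso]
  change IsIso ((Functor.Monoidal.εIso (toCentralLocalization S)).symm.inv ≫
    (toCentralLocalization S).map s ≫ (Functor.Monoidal.εIso (toCentralLocalization S)).symm.hom)
  infer_instance

/-- Write `f` as a left fraction. Its denominator followed by a suitable `k` is some `s ∈ S`, so
clearing denominators by `s` leaves the numerator followed by `k`. -/
lemma exists_centralMap_mul (S : Submonoid (End (𝟙_ T)))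
    (f : End (𝟙_ (CentralLocalization S))) :
    ∃ r, ∃ s ∈ S, f * centralMap S s = centralMap S r := by
  let Q := toCentralLocalization S
  let e := Functor.Monoidal.εIso Q
  obtain ⟨z, hz⟩ := Localization.exists_leftFraction Q (torsion S).trW
    (X := 𝟙_ T) (Y := 𝟙_ T) (e.inv ≫ f ≫ e.hom)
  have hs := isIso_toCentralLocalization_map S z.s z.hs
  obtain ⟨s, hsS, k, hk⟩ := exists_comp_eq_act S z.s z.hs
  rw [act_unit] at hk
  have hk' : Q.map z.s ≫ Q.map k = Q.map s := by rw [← Q.map_comp, hk]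
  refine ⟨show 𝟙_ T ⟶ 𝟙_ T from z.f ≫ k, s, hsS, ?_⟩
  -- The product `x * y` in `End` is `y ≫ x`, so commuting the factors produces the composite that
  -- starts with `f`.
  rw [mul_comm]
  change f ≫ e.hom ≫ Q.map s ≫ e.inv = e.hom ≫ Q.map (z.f ≫ k) ≫ e.inv
  have h : f ≫ e.hom = e.hom ≫ Q.map z.f ≫ inv (Q.map z.s) :=
    (Iso.inv_comp_eq e).1 hz
  rw [reassoc_of% h, ← hk', Q.map_comp]
  simp

/-- The calculus of fractions equalizes `x` and `y` by some morphism with torsion cone; that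
morphism divides an element of `S`, which then equalizes them too. -/
lemma exists_mul_eq_of_centralMap_eq (S : Submonoid (End (𝟙_ T))) {x y : End (𝟙_ T)}
    (h : centralMap S x = centralMap S y) : ∃ s ∈ S, s * x = s * y := by
  let Q := toCentralLocalization S
  let e := Functor.Monoidal.εIso Q
  have h0 : e.hom ≫ Q.map x ≫ e.inv = e.hom ≫ Q.map y ≫ e.inv := h
  have h1 : Q.map x = Q.map y := by simpa using h0
  obtain ⟨z, s, hs, hz⟩ := (MorphismProperty.map_eq_iff_postcomp Q (torsion S).trW _ _).1 h1
  obtain ⟨t, ht, k, hk⟩ := exists_comp_eq_act S s hs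
  rw [act_unit] at hk
  refine ⟨t, ht, ?_⟩
  change x ≫ t = y ≫ t
  rw [← hk, reassoc_of% hz]

/-- The central ring of `S⁻¹T` is the localization at `S` of the central ring of `T`. -/
theorem isLocalization_centralMap (S : Submonoid (End (𝟙_ T))) :
    @IsLocalization (End (𝟙_ T)) _ S (End (𝟙_ (CentralLocalization S))) _
      (centralMap S).toAlgebra := by
  algebraize [centralMap S]
  exact
    { map_units := fun s => isUnit_centralMap S s.2
      surj := fun f => by
        obtain ⟨r, s, hs, h⟩ := exists_centralMap_mul S f
        exact ⟨(r, ⟨s, hs⟩), h⟩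
      exists_of_eq := fun {x y} h => by
        obtain ⟨s, hs, h⟩ := exists_mul_eq_of_centralMap_eq S h
        exact ⟨⟨s, hs⟩, h⟩ }

end CentralLocalization

/-! ### Prime ideals of a Verdier quotient, and the image of `Spec(Q)`. -/

section LiftPrime

variable {T : Type u} [Category.{u} T] [HasZeroObject T] [HasShift T ℤ] [Preadditive T]
  [∀ n : ℤ, (shiftFunctor T n).Additive] [Pretriangulated T]
  [MonoidalCategory T] [SymmetricCategory T] [IsTensorTriangulated T] [IsTriangulated T]
  {D : Type u} [Category.{u} D] (L : T ⥤ D) (I : ObjectProperty T) [IsTTIdeal I]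
  [L.IsLocalization I.trW]

/-- As `I ≤ J`, the functor to `T/J` factors through `T/I`, and its kernel is exactly `J`. A retract
of a zero object is zero. This makes membership in the image of `J` in `T/I` independent of the
chosen preimage. -/
lemma prop_of_retract_toTTQuotient {J : ObjectProperty T} [IsTTIdeal J] (hIJ : I ≤ J) {a b : T}
    (r : Retract ((toTTQuotient L I).obj a) ((toTTQuotient L I).obj b)) (hb : J b) : J a := by
  let G := Localization.lift (toVerdier J) (isInvertedBy_toVerdier hIJ) (toTTQuotient L I)
  let e : toTTQuotient L I ⋙ G ≅ toVerdier J :=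
    Localization.fac (toVerdier J) (isInvertedBy_toVerdier hIJ) (toTTQuotient L I)
  have hz : IsZero (G.obj ((toTTQuotient L I).obj b)) :=
    ((toVerdier_isZero_iff J b).2 hb).of_iso (e.app b)
  have hr := r.map G
  rw [← toVerdier_isZero_iff J]
  refine IsZero.of_iso (Y := G.obj ((toTTQuotient L I).obj a)) ?_ (e.app a).symm
  rw [IsZero.iff_id_eq_zero, ← hr.retract, hz.eq_zero_of_tgt hr.i, zero_comp]

/-- The essential image in `T / I` of a tt-ideal of `T`. -/
def quotientIdeal (J : ObjectProperty T) : ObjectProperty (TTQuotient L I) :=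
  J.map (toTTQuotient L I)

lemma quotientIdeal_obj_iff {J : ObjectProperty T} [IsTTIdeal J] (hIJ : I ≤ J) (a : T) :
    quotientIdeal L I J ((toTTQuotient L I).obj a) ↔ J a := by
  refine ⟨?_, fun h => J.prop_map_obj _ h⟩
  rintro ⟨b, hb, ⟨e⟩⟩
  exact prop_of_retract_toTTQuotient L I hIJ e.symm.retract hb

lemma isTTIdeal_quotientIdeal {J : ObjectProperty T} [IsTTIdeal J] (hIJ : I ≤ J) :
    IsTTIdeal (quotientIdeal L I J) := by
  let Q := toTTQuotient L I
  let K := quotientIdeal L I J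
  have hK : ∀ a, K (Q.obj a) ↔ J a := quotientIdeal_obj_iff L I hIJ
  have hi : K.IsClosedUnderIsomorphisms := inferInstanceAs (J.map Q).IsClosedUnderIsomorphisms
  have hr : K.IsStableUnderRetracts := ⟨by
    rintro x y r ⟨b, hb, ⟨e⟩⟩
    refine K.prop_of_iso (Q.objObjPreimageIso x) ((hK _).2 ?_)
    exact prop_of_retract_toTTQuotient L I hIJ
      (((Retract.ofIso (Q.objObjPreimageIso x)).trans r).trans (Retract.ofIso e.symm)) hb⟩
  have h0 : K.ContainsZero := ⟨⟨Q.obj (HasZeroObject.zero' T |>.1),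
    Q.map_isZero (isZero_zero T), (hK _).2 (J.prop_of_isZero (isZero_zero T))⟩⟩
  have hs : K.IsStableUnderShift ℤ := ⟨fun n => ⟨by
    rintro x ⟨b, hb, ⟨e⟩⟩
    exact K.prop_of_iso ((show Q.obj (b⟦n⟧) ≅ (Q.obj b)⟦n⟧ from (Q.commShiftIso n).app b) ≪≫
      (shiftFunctor _ n).mapIso e)
      ((hK _).2 (J.le_shift n b hb))⟩⟩
  have h2 : K.IsTriangulatedClosed₂ := .mk' (by
    -- Distinguished triangles of the quotient are, by construction, those isomorphic to images of
    -- distinguished triangles of `T`, so the two-out-of-three property is inherited from `J`.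
    rintro X ⟨Y, e, hY⟩ h1 h3
    refine K.prop_of_iso (Triangle.π₂.mapIso e).symm ((hK _).2 ?_)
    exact J.ext_of_isTriangulatedClosed₂ Y hY
      ((hK _).1 (K.prop_of_iso (Triangle.π₁.mapIso e) h1))
      ((hK _).1 (K.prop_of_iso (Triangle.π₃.mapIso e) h3)))
  exact { tensor_mem := by
            rintro x y ⟨b, hb, ⟨e⟩⟩
            exact K.prop_of_iso ((Functor.Monoidal.μIso Q _ _).symm ≪≫
              (Q.objObjPreimageIso x ⊗ᵢ e)) ((hK _).2 (IsTTIdeal.tensor_mem _ b hb)) }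

/-- The prime ideal of `T / I` induced by a prime ideal of `T` containing `I`. -/
def quotientPrime (P : Spc T) (hP : I ≤ P.ideal) : Spc (TTQuotient L I) where
  ideal := quotientIdeal L I P.ideal
  isTTIdeal := isTTIdeal_quotientIdeal L I hP
  proper := ⟨(toTTQuotient L I).obj (𝟙_ T),
    fun h => P.unit_notMem ((quotientIdeal_obj_iff L I hP _).1 h)⟩
  mem_or_mem x y h := by
    have := isTTIdeal_quotientIdeal L I hP
    let Q := toTTQuotient L I
    have h' := (quotientIdeal L I P.ideal).prop_of_iso
      ((Q.objObjPreimageIso x ⊗ᵢ Q.objObjPreimageIso y).symm ≪≫ Functor.Monoidal.μIso Q _ _) h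
    exact (P.mem_or_mem _ _ ((quotientIdeal_obj_iff L I hP _).1 h')).imp
      (fun h => ⟨_, h, ⟨Q.objObjPreimageIso x⟩⟩) (fun h => ⟨_, h, ⟨Q.objObjPreimageIso y⟩⟩)

lemma comap_quotientPrime (P : Spc T) (hP : I ≤ P.ideal) :
    Spc.comap (toTTQuotient L I) (quotientPrime L I P hP) = P := by
  ext a
  exact quotientIdeal_obj_iff L I hP a

/-- Every object of the quotient is isomorphic to the image of an object of `T`. Therefore the basic
open sets `U(x)` are exactly the preimages of the sets `U(a)`, and a prime is determined by its
preimage in `T`. -/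
lemma isEmbedding_comap_toTTQuotient : Topology.IsEmbedding (Spc.comap (toTTQuotient L I)) := by
  let Q := toTTQuotient L I
  refine ⟨⟨?_⟩, fun P P' h => ?_⟩
  · change generateFrom _ = TopologicalSpace.induced _ (generateFrom _)
    rw [induced_generateFrom_eq]
    congr 1
    ext U
    constructor
    · rintro ⟨x, rfl⟩
      refine ⟨_, ⟨Q.objPreimage x, rfl⟩, ?_⟩
      ext P
      exact P.ideal.prop_iff_of_iso (Q.objObjPreimageIso x)
    · rintro ⟨_, ⟨a, rfl⟩, rfl⟩
      exact ⟨Q.obj a, rfl⟩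
  · ext x
    rw [← P.ideal.prop_iff_of_iso (Q.objObjPreimageIso x),
      ← P'.ideal.prop_iff_of_iso (Q.objObjPreimageIso x)]
    exact iff_of_eq (congrFun (congrArg Spc.ideal h) (Q.objPreimage x))

open scoped ZeroObject in
lemma range_comap_toTTQuotient :
    Set.range (Spc.comap (toTTQuotient L I)) = {P | I ≤ P.ideal} := by
  ext P
  constructor
  · rintro ⟨P, rfl⟩ a ha
    refine P.ideal.prop_of_isZero ?_
    -- The cone of `0 ⟶ a` is `a`, so this morphism becomes invertible and `a` becomes a zero
    -- object.
    have h1 : I.trW (0 : (0 : T) ⟶ a) :=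
      (I.trW_iff _).2 ⟨a, 𝟙 a, 0, contractible_distinguished₁ a, ha⟩
    have := Localization.inverts (toTTQuotient L I) I.trW _ h1
    exact ((toTTQuotient L I).map_isZero (isZero_zero T)).of_iso
      (asIso ((toTTQuotient L I).map (0 : (0 : T) ⟶ a))).symm
  · exact fun hP => ⟨_, comap_quotientPrime L I P hP⟩

/-- If `s` is invertible in `T/J` then so is its action on every object. On an object killed by `s`
this action is zero, so the object vanishes in `T/J`. Taken with `J` prime, this translates `torsion
S ≤ P` into a condition on `ρ(P)`. -/
lemma torsion_le_iff (S : Submonoid (End (𝟙_ T))) (J : ObjectProperty T) [IsTTIdeal J] :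
    torsion S ≤ J ↔ ∀ s ∈ S, J.trW (show 𝟙_ T ⟶ 𝟙_ T from s) := by
  refine ⟨fun h s hs => ObjectProperty.trW_monotone h _ (trW_of_mem S hs), ?_⟩
  rintro h a ⟨s, hs, h0⟩
  -- Up to the unitors the action of `s` on `a` is `s ▷ a`, and `J.trW` is stable under whiskering.
  have h1 : J.trW (act s a) :=
    (MorphismProperty.cancel_left_of_respectsIso _ _ _).2
      ((MorphismProperty.cancel_right_of_respectsIso _ _ _).2
        (MorphismProperty.IsMonoidal.whiskerRight _ (h s hs) a))
  have h2 := isIso_toVerdier_map J _ h1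
  rw [h0, Functor.map_zero] at h2
  rw [← toVerdier_isZero_iff J, IsZero.iff_id_eq_zero,
    ← IsIso.hom_inv_id (0 : (toVerdier J).obj a ⟶ (toVerdier J).obj a), zero_comp]

lemma notMem_rho_iff (P : Spc T) (r : End (𝟙_ T)) :
    r ∉ PrimeSpectrum.asIdeal ((rho T).base P) ↔ P.ideal.trW (show 𝟙_ T ⟶ 𝟙_ T from r) := by
  rw [mem_rho_iff, ObjectProperty.trW_iff]
  push Not
  simp only [exists_prop]

theorem range_comap_toCentralLocalization (S : Submonoid (End (𝟙_ T))) :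
    Set.range (Spc.comap (toCentralLocalization S)) =
      {P : Spc T | ∀ s ∈ S, s ∉ PrimeSpectrum.asIdeal ((rho T).base P)} := by
  rw [range_comap_toTTQuotient]
  ext P
  exact (torsion_le_iff S P.ideal).trans (forall₂_congr fun s _ => (notMem_rho_iff P s).symm)

end LiftPrime

end TTGeometry

namespace TTGeometry

/-! ### A stalkwise criterion for an inverse image sheaf. -/

section Pullback

open TopCat TopCat.Presheaf

/-- Left adjoints are unique up to isomorphism, so whether the transpose of `φ` is invertible does
not depend on the chosen one. This permits replacing the abstract inverse image functor by an
explicit construction. -/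
lemma isIso_homEquiv_symm {C D : Type*} [Category* C] [Category* D] {L L' : C ⥤ D} {R : D ⥤ C}
    (adj : L ⊣ R) (adj' : L' ⊣ R) {c : C} {d : D} (φ : c ⟶ R.obj d)
    (h : IsIso ((adj'.homEquiv c d).symm φ)) : IsIso ((adj.homEquiv c d).symm φ) := by
  have : (adj.homEquiv c d).symm φ =
      (adj.leftAdjointUniq adj').hom.app c ≫ (adj'.homEquiv c d).symm φ := by
    rw [Equiv.symm_apply_eq, Adjunction.homEquiv_naturality_right,
      Adjunction.homEquiv_leftAdjointUniq_hom_app, ← Adjunction.homEquiv_unit,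
      Equiv.apply_symm_apply]
  rw [this]
  infer_instance

variable {X Y : TopCat.{u}} (f : X ⟶ Y)

/-- Under the identification of the stalk of the inverse image at `x` with `F_{f x}`, the stalk of
`ψ` becomes the stalk map of its transpose `F ⟶ f_* G`. On germs both sides are the adjunction unit
followed by `ψ`. -/
lemma stalkPullbackHom_comp_map (F : Y.Presheaf CommRingCat.{u}) (G : X.Presheaf CommRingCat.{u})
    (ψ : (Presheaf.pullback CommRingCat.{u} f).obj F ⟶ G) (x : X) :
    stalkPullbackHom CommRingCat.{u} f F x ≫ (stalkFunctor CommRingCat.{u} x).map ψ =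
      (stalkFunctor CommRingCat.{u} (f x)).map
        ((Presheaf.pullbackPushforwardAdjunction CommRingCat.{u} f).homEquiv F G ψ) ≫
      G.stalkPushforward CommRingCat.{u} f x := by
  refine TopCat.Presheaf.stalk_hom_ext _ fun U hU => ?_
  let adj := Presheaf.pullbackPushforwardAdjunction CommRingCat.{u} f
  let ψ' : F ⟶ (Presheaf.pushforward CommRingCat.{u} f).obj G := adj.homEquiv F G ψ
  have h1 : F.germ U (f x) hU ≫ (stalkFunctor CommRingCat.{u} (f x)).map ψ' ≫
      G.stalkPushforward CommRingCat.{u} f x =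
      ψ'.app (op U) ≫ G.germ ((Opens.map f).obj U) x hU :=
    (stalkFunctor_map_germ_assoc U (f x) hU ψ' _).trans
      (congrArg (ψ'.app (op U) ≫ ·) (stalkPushforward_germ _ f G U x hU))
  have h2 : ψ'.app (op U) = (adj.unit.app F).app (op U) ≫ ψ.app (op ((Opens.map f).obj U)) := by
    change (adj.homEquiv F G ψ).app (op U) = _
    rw [Adjunction.homEquiv_unit]
    rfl
  refine Eq.trans ?_ h1.symm
  rw [h2, Category.assoc]
  refine (Category.assoc _ _ _).symm.trans ((congrArg (· ≫ (stalkFunctor CommRingCat.{u} x).map ψ)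
    (germ_stalkPullbackHom CommRingCat.{u} f F x U hU)).trans ?_)
  refine (Category.assoc _ _ _).trans (congrArg ((adj.unit.app F).app (op U) ≫ ·) ?_)
  exact stalkFunctor_map_germ _ x hU ψ

/-- A morphism `F ⟶ f_* G` of sheaves that induces isomorphisms `F_{f x} ⟶ G_x` corresponds to
an isomorphism `f⁻¹ F ⟶ G`. -/
theorem isIso_pullback_homEquiv_symm (F : Y.Sheaf CommRingCat.{u}) (G : X.Sheaf CommRingCat.{u})
    (φ : F ⟶ (TopCat.Sheaf.pushforward CommRingCat.{u} f).obj G)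
    (h : ∀ x : X, IsIso ((stalkFunctor CommRingCat.{u} (f x)).map φ.hom ≫
      G.presheaf.stalkPushforward CommRingCat.{u} f x)) :
    IsIso (((TopCat.Sheaf.pullbackPushforwardAdjunction CommRingCat.{u} f).homEquiv F G).symm φ) := by
  let adj := TopCat.Sheaf.pullbackPushforwardAdjunction CommRingCat.{u} f
  -- The explicit left adjoint: sheafification of the presheaf inverse image. Its stalks are
  -- accessible, since both steps have known effect on stalks.
  let adj' : _ ⊣ TopCat.Sheaf.pushforward CommRingCat.{u} f :=
    Functor.sheafPullbackConstruction.sheafAdjunctionContinuous (Opens.map f) CommRingCat.{u}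
      (Opens.grothendieckTopology Y) (Opens.grothendieckTopology X)
  let F' := (Presheaf.pullback CommRingCat.{u} f).obj F.presheaf
  let F'' : X.Sheaf CommRingCat.{u} :=
    (presheafToSheaf (Opens.grothendieckTopology X) CommRingCat.{u}).obj F'
  let η : F' ⟶ F''.presheaf := toSheafify (Opens.grothendieckTopology X) F'
  let ψ : F'' ⟶ G := (adj'.homEquiv F G).symm φ
  -- Transposing `φ` at the level of sheaves and then restricting along the sheafification map `η`
  -- is the same as transposing it at the level of presheaves.
  have hψ₀ : (Presheaf.pullbackPushforwardAdjunction CommRingCat.{u} f).homEquiv F.presheaf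
      G.presheaf (η ≫ ψ.hom) = φ.hom := by
    have h1 : adj'.homEquiv F G ψ = φ := Equiv.apply_symm_apply _ _
    rw [← h1]
    have h2 := congrArg (fun k => k.hom) (Adjunction.restrictFullyFaithful_homEquiv_apply
      (((Opens.map f).op.lanAdjunction CommRingCat.{u}).comp
        (sheafificationAdjunction (Opens.grothendieckTopology X) CommRingCat.{u}))
      (fullyFaithfulSheafToPresheaf (Opens.grothendieckTopology Y) CommRingCat.{u})
      (Functor.FullyFaithful.id (Sheaf (Opens.grothendieckTopology X) CommRingCat.{u}))
      (L := Functor.sheafPullbackConstruction.sheafPullback (Opens.map f) CommRingCat.{u}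
        (Opens.grothendieckTopology Y) (Opens.grothendieckTopology X))
      (R := (Opens.map f).sheafPushforwardContinuous CommRingCat.{u}
        (Opens.grothendieckTopology Y) (Opens.grothendieckTopology X))
      (Iso.refl _) (Iso.refl _) (X := F) (Y := G) ψ)
    refine Eq.trans ?_ h2.symm
    rw [Adjunction.homEquiv_unit]
    refine NatTrans.ext (funext fun U => ?_)
    refine Eq.trans ?_ (congrArg (((((Opens.map f).op.lanAdjunction CommRingCat.{u}).comp
        (sheafificationAdjunction (Opens.grothendieckTopology X) CommRingCat.{u})).unit.app
          F.presheaf).app U ≫ ·) ((Category.id_comp _).trans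
            (Category.comp_id (ψ.hom.app (op ((Opens.map f).obj U.unop)))))).symm
    rw [Adjunction.comp_unit_app]
    exact (Category.assoc _ _ _).symm
  have hx : ∀ x, IsIso ((stalkFunctor CommRingCat.{u} x).map ψ.hom) := by
    intro x
    have h1 : IsIso (stalkPullbackHom CommRingCat.{u} f F.presheaf x) :=
      (stalkPullbackIso CommRingCat.{u} f F.presheaf x).isIso_hom
    -- The stalk map of `φ` is the composite of the stalk identification, the stalk of `η` and the
    -- stalk of `ψ`. The first two are isomorphisms and so is the composite, hence so is the third.
    have h2 := stalkPullbackHom_comp_map f F.presheaf G.presheaf (η ≫ ψ.hom) x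
    rw [hψ₀, Functor.map_comp] at h2
    have h3 : IsIso ((stalkFunctor CommRingCat.{u} x).map η) :=
      stalkFunctor_map_unit_toSheafify_isIso x CommRingCat.{u} F'
    have h4 := h x
    have h5 := (congrArg (fun k => IsIso k) h2).mpr h4
    have h6 := (isIso_comp_left_iff _ _).1 h5
    exact @IsIso.of_isIso_comp_left _ _ _ _ _ _ _ h3 h6
  have : IsIso ψ := isIso_of_stalkFunctor_map_iso (F := F'') (G := G) ψ
  exact isIso_homEquiv_symm adj adj' φ this

end Pullback

/-! ### Factorization through stalkwise isomorphic embeddings, and cartesian squares. -/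

section LocallyRingedSpace

open AlgebraicGeometry

/-- Let `f` be a morphism of locally ringed spaces that is a topological embedding and induces
isomorphisms on stalks. Every morphism whose range is contained in the range of `f` factors
through `f`. -/
theorem exists_lift_of_isEmbedding {W X Y : LocallyRingedSpace.{u}} (f : X ⟶ Y) (g : W ⟶ Y)
    (hf : Topology.IsEmbedding f.base) (hs : ∀ x, IsIso (f.stalkMap x))
    (hg : Set.range g.base ⊆ Set.range f.base) : ∃ l : W ⟶ X, l ≫ f = g := by
  obtain ⟨l, hl⟩ : ∃ l : W.toTopCat ⟶ X.toTopCat, l ≫ f.base = g.base := by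
    choose l hl using fun w => hg ⟨w, rfl⟩
    have hc : Continuous l := by
      rw [hf.continuous_iff, show f.base ∘ l = g.base from funext hl]
      exact g.base.hom.continuous
    exact ⟨TopCat.ofHom ⟨l, hc⟩, by ext w; exact hl w⟩
  -- Taking `g` apart allows its continuous map to be replaced by `l ≫ f.base`, so that its sheaf
  -- map can be read as a morphism from the structure sheaf of `Y` to `f_* l_*` of that of `W`.
  obtain ⟨⟨gb, gc⟩, gp⟩ := g
  dsimp only at hl
  subst hl
  let A := CommRingCat.{u}
  let φ : Y.sheaf ⟶ (TopCat.Sheaf.pushforward A f.base).obj X.sheaf := ⟨f.c⟩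
  let γ : Y.sheaf ⟶ (TopCat.Sheaf.pushforward A f.base).obj
    ((TopCat.Sheaf.pushforward A l).obj W.sheaf) := ⟨gc⟩
  let adj := TopCat.Sheaf.pullbackPushforwardAdjunction A f.base
  have := isIso_pullback_homEquiv_symm f.base Y.sheaf X.sheaf φ hs
  -- The structure sheaf of `X` is the inverse image of that of `Y`, so the transpose of `γ` along
  -- `f` is a morphism out of it.
  let c : X.sheaf ⟶ (TopCat.Sheaf.pushforward A l).obj W.sheaf :=
    inv ((adj.homEquiv _ _).symm φ) ≫ (adj.homEquiv _ _).symm γ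
  have hc : φ ≫ (TopCat.Sheaf.pushforward A f.base).map c = γ := by
    have := adj.homEquiv_naturality_right ((adj.homEquiv _ _).symm φ) c
    rw [Equiv.apply_symm_apply, IsIso.hom_inv_id_assoc, Equiv.apply_symm_apply] at this
    exact this.symm
  let l' : W.toPresheafedSpace ⟶ X.toPresheafedSpace := ⟨l, c.hom⟩
  have hl' : l' ≫ f.toHom = ⟨l ≫ f.base, gc⟩ := by
    refine congrArg (PresheafedSpace.Hom.mk (l ≫ f.base)) ?_
    exact congrArg (fun k => k.hom) hc
  refine ⟨⟨l', fun w => ?_⟩, ?_⟩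
  -- The stalk map of the lift is that of `g` preceded by the inverse of an isomorphism, so it is
  -- local because that of `g` is.
  · have h1 := gp w
    have h2 := PresheafedSpace.stalkMap.comp l' f.toHom w
    have h3 : IsLocalHom ((f.toHom.stalkMap (l w) ≫ l'.stalkMap w).hom) := by
      refine (congrArg (fun k => IsLocalHom (CommRingCat.Hom.hom k)) h2).mp ?_
      rw [hl']
      exact h1
    have h4 := hs (l w)
    have h5 : l'.stalkMap w = inv (f.stalkMap (l w)) ≫ f.stalkMap (l w) ≫ l'.stalkMap w :=
      (IsIso.inv_hom_id_assoc _ _).symm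
    refine (congrArg (fun k => IsLocalHom (CommRingCat.Hom.hom k)) h5).mpr ?_
    exact @CommRingCat.isLocalHom_comp _ _ _ _ _ h3 (isLocalHom_of_isIso _)
  · exact LocallyRingedSpace.Hom.ext' hl'

/-- Injectivity on points and epimorphic stalk maps already suffice in sheafed spaces, and the
forgetful functor reflects monomorphisms. -/
lemma mono_of_isEmbedding {X Y : LocallyRingedSpace.{u}} (f : X ⟶ Y)
    (hf : Topology.IsEmbedding f.base) (hs : ∀ x, IsIso (f.stalkMap x)) : Mono f := by
  refine LocallyRingedSpace.forgetToSheafedSpace.mono_of_mono_map ?_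
  refine SheafedSpace.mono_of_base_injective_of_stalk_epi _ hf.injective fun x => ?_
  have := hs x
  exact inferInstanceAs (Epi (f.stalkMap x))

/-- The first leg of any cone lands in the range of `f`: by `hr` this is a condition on its image in
`Y`, which lies in the range of `j`. It therefore lifts through `f`. Compatibility with the second
leg can be tested after the monomorphism `j`, and uniqueness after the monomorphism `f`. -/
theorem isPullback_of_isEmbedding {X Y X' Y' : LocallyRingedSpace.{u}} {f : X' ⟶ X}
    {p' : X' ⟶ Y'} {p : X ⟶ Y} {j : Y' ⟶ Y} (w : f ≫ p = p' ≫ j)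
    (hf : Topology.IsEmbedding f.base) (hs : ∀ x, IsIso (f.stalkMap x)) [Mono j]
    (hr : ∀ x, p.base x ∈ Set.range j.base → x ∈ Set.range f.base) : IsPullback f p' p j := by
  have := mono_of_isEmbedding f hf hs
  have hl : ∀ s : PullbackCone p j, ∃ l, l ≫ f = s.fst := fun s =>
    exists_lift_of_isEmbedding f s.fst hf hs (by
      rintro _ ⟨x, rfl⟩
      exact hr _ ⟨s.snd.base x, congrArg (fun k => k.base x) s.condition.symm⟩)
  choose l hl using hl
  refine ⟨⟨w⟩, ⟨PullbackCone.IsLimit.mk w l hl (fun s => ?_) (fun s m h1 _ => ?_)⟩⟩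
  · rw [← cancel_mono j, Category.assoc, ← w, reassoc_of% hl s, s.condition]
  · rw [← cancel_mono f, h1, hl]

end LocallyRingedSpace

end TTGeometry

namespace TTGeometry

/-! ### Stalks of the structure presheaf. -/

section Stalks

variable {T : Type u} [Category.{u} T] [HasZeroObject T] [HasShift T ℤ] [Preadditive T]
  [∀ n : ℤ, (shiftFunctor T n).Additive] [Pretriangulated T]
  [MonoidalCategory T] [SymmetricCategory T] [IsTensorTriangulated T] [IsTriangulated T]

lemma frac_eq_zero_iff (J : ObjectProperty T) [IsTTIdeal J] {y : T} (φ s : 𝟙_ T ⟶ y)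
    (hs : J.trW s) : frac J φ s hs = 0 ↔ ∃ (z : T) (t : y ⟶ z), J.trW t ∧ φ ≫ t = 0 := by
  have hs' := isIso_toVerdier_map J s hs
  have h1 : frac J φ s hs = 0 ↔ (toVerdier J).map φ = (toVerdier J).map 0 := by
    rw [Functor.map_zero]
    change (toVerdier J).map φ ≫ inv ((toVerdier J).map s) = 0 ↔ _
    exact Preadditive.IsIso.comp_right_eq_zero _ _
  rw [h1, MorphismProperty.map_eq_iff_postcomp (toVerdier J) J.trW]
  simp only [zero_comp, exists_prop]

/-- The stalk of the structure presheaf at `P` is the endomorphism ring of the unit in `T / P`. -/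
lemma bijective_stalkDesc (P : Spc T) : Function.Bijective (stalkDesc T P).hom := by
  constructor
  · rw [injective_iff_map_eq_zero]
    intro x hx
    obtain ⟨U, hP, f, rfl⟩ := TopCat.Presheaf.exists_germ_eq _ x
    obtain ⟨y, φ, s, hs, rfl⟩ := exists_sec U f
    rw [stalkDesc_germ_sec, frac_eq_zero_iff] at hx
    obtain ⟨z, t, ⟨c, p, q, hT, hc⟩, ht⟩ := hx
    -- The numerator is annihilated by a morphism `t` with cone `c ∈ P`. Every prime in `U(c)`
    -- contains `c`, so the fraction already vanishes over this neighbourhood of `P`.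
    let V : Opens (TopCat.of (Spc T)) := U ⊓ ⟨supportCompl c, isOpen_supportCompl c⟩
    let i : V ⟶ U := homOfLE inf_le_left
    have hV : P ∈ V := ⟨hP, hc⟩
    have h0 : (structurePresheaf T).map i.op (sec U φ s hs) = 0 := by
      rw [res_sec]
      exact (frac_eq_zero_iff _ φ s _).2 ⟨z, t, ⟨c, p, q, hT, fun Q hQ => hQ.2⟩, ht⟩
    rw [← TopCat.Presheaf.germ_res_apply _ i P hV, h0, map_zero]
  · intro f
    obtain ⟨y, φ, s, ⟨c, p, q, hT, hc⟩, rfl⟩ := exists_frac P.ideal f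
    -- With `c ∈ P` the cone of the denominator, the fraction is already defined over `U(c)`.
    let V : Opens (TopCat.of (Spc T)) := ⟨supportCompl c, isOpen_supportCompl c⟩
    exact ⟨(structurePresheaf T).germ V P hc (sec V φ s ⟨c, p, q, hT, fun Q hQ => hQ⟩),
      stalkDesc_germ_sec P V hc φ s _⟩

end Stalks

/-! ### Iterated Verdier quotients. -/

section Quotient

variable {T : Type u} [Category.{u} T] [HasZeroObject T] [HasShift T ℤ] [Preadditive T]
  [∀ n : ℤ, (shiftFunctor T n).Additive] [Pretriangulated T]
  [MonoidalCategory T] [SymmetricCategory T] [IsTensorTriangulated T] [IsTriangulated T]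

lemma bijective_endUnitMap {C : Type u} [Category.{u} C] [Preadditive C] [MonoidalCategory C]
    {E : Type u} [Category.{u} E] [Preadditive E] [MonoidalCategory E]
    (G : C ⥤ E) [G.Additive] [G.Full] [G.Faithful] (e : G.obj (𝟙_ C) ≅ 𝟙_ E) :
    Function.Bijective (endUnitMap G e) := by
  have h : ⇑(endUnitMap G e) = e.conj ∘ (Functor.FullyFaithful.ofFullyFaithful G).homEquiv := rfl
  rw [h]
  exact e.conj.bijective.comp (Equiv.bijective _)

/-- If `H` is itself a localization for the same class, the induced functor out of `T/I` is an
equivalence, since it agrees up to isomorphism with the canonical equivalence between two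
localizations. In particular it is fully faithful. -/
lemma bijective_liftRing (I : ObjectProperty T) [IsTTIdeal I]
    {E : Type u} [Category.{u} E] [Preadditive E] [MonoidalCategory E]
    (H : T ⥤ E) [H.Additive] (hH : H.IsLocalization I.trW) (e : H.obj (𝟙_ T) ≅ 𝟙_ E) :
    Function.Bijective (liftRing I H (Localization.inverts H I.trW) e) := by
  let G : VerdierQuotient I ⥤ E :=
    Localization.Construction.lift H (Localization.inverts H I.trW)
  have hG : toVerdier I ⋙ G = H := Localization.Construction.fac H _
  let _ : Localization.Lifting (toVerdier I) I.trW H G := ⟨eqToIso hG⟩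
  let E' := Localization.uniq (toVerdier I) H I.trW
  have : G.IsEquivalence := Functor.isEquivalence_of_iso
    (Localization.liftNatIso (toVerdier I) I.trW H H E'.functor G (Iso.refl H))
  have : G.Additive := by
    rw [Localization.functor_additive_iff (toVerdier I) I.trW, hG]
    infer_instance
  exact bijective_endUnitMap G e

variable {D : Type u} [Category.{u} D] (L : T ⥤ D) (I : ObjectProperty T) [IsTTIdeal I]
  [L.IsLocalization I.trW]

/-- The Verdier quotient of `T / I` by `J` is the Verdier quotient of `T` by the preimage of
`J`. -/
lemma isLocalization_comp_toVerdier (J : ObjectProperty (TTQuotient L I)) [IsTTIdeal J] :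
    (toTTQuotient L I ⋙ toVerdier J).IsLocalization (J.inverseImage (toTTQuotient L I)).trW := by
  let Q := toTTQuotient L I
  refine Functor.IsLocalization.comp Q (toVerdier J) I.trW J.trW _ ?_ ?_ ?_
  · exact fun a b f hf => isIso_toVerdier_map J _ ((J.inverseImage_trW_iff Q f).1 hf)
  · intro a b f hf
    have := Localization.inverts Q I.trW f hf
    exact (J.inverseImage_trW_iff Q f).2 (J.trW_of_isIso _)
  · intro a b f hf
    -- By the calculus of fractions every arrow of `T/I` is isomorphic to the image of an arrow of
    -- `T`; if its cone lies in `J`, the cone of the latter lies in the preimage of `J`.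
    have := Localization.essSurj_mapArrow Q I.trW
    let g := Q.mapArrow.objPreimage (Arrow.mk f)
    let e : Q.mapArrow.obj g ≅ Arrow.mk f := Q.mapArrow.objObjPreimageIso _
    refine ⟨_, _, g.hom, (J.inverseImage_trW_iff Q _).2 ?_, ⟨e⟩⟩
    exact (J.trW.arrow_mk_iso_iff e).2 hf

lemma bijective_mapRing_toTTQuotient (J : ObjectProperty (TTQuotient L I)) [IsTTIdeal J] :
    Function.Bijective (mapRing (toTTQuotient L I) (I := J.inverseImage (toTTQuotient L I))
      (J := J) le_rfl) :=
  bijective_liftRing _ _ (isLocalization_comp_toVerdier L I J) _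

end Quotient

/-! ### `Spec(Q)` is an isomorphism on stalks. -/

section StalkMap

variable {T : Type u} [Category.{u} T] [HasZeroObject T] [HasShift T ℤ] [Preadditive T]
  [∀ n : ℤ, (shiftFunctor T n).Additive] [Pretriangulated T]
  [MonoidalCategory T] [SymmetricCategory T]
  {T' : Type u} [Category.{u} T'] [HasZeroObject T'] [HasShift T' ℤ] [Preadditive T']
  [∀ n : ℤ, (shiftFunctor T' n).Additive] [Pretriangulated T']
  [MonoidalCategory T'] [SymmetricCategory T']
  (F : T ⥤ T') [F.Monoidal] [F.CommShift ℤ] [F.IsTriangulated]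
  [IsTensorTriangulated T] [IsTriangulated T] [IsTensorTriangulated T'] [IsTriangulated T']

variable (T) in
/-- The stalk of the structure sheaf at `P` is the endomorphism ring of the unit in `T / P`. -/
lemma exists_stalkEquiv (P : Spc T) :
    ∃ e : (structureSheaf T).presheaf.stalk (P : TopCat.of (Spc T)) ≃+*
      End (𝟙_ (VerdierQuotient P.ideal)),
      ∀ (U : Opens (TopCat.of (Spc T))) (hP : P ∈ U) {y : T} (φ s : 𝟙_ T ⟶ y)
        (hs : (idealOff (U : Set (Spc T))).trW s),
        e ((structureSheaf T).presheaf.germ U P hP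
          ((toStructureSheaf T).app (op U) (sec U φ s hs))) =
          frac P.ideal φ s (ObjectProperty.trW_monotone (idealOff_le hP) _ hs) := by
  let e₁ := (asIso ((TopCat.Presheaf.stalkFunctor CommRingCat.{u} (P : TopCat.of (Spc T))).map
      (toStructureSheaf T))).commRingCatIsoToRingEquiv
  let e₂ := RingEquiv.ofBijective (stalkDesc T P).hom (bijective_stalkDesc P)
  refine ⟨e₁.symm.trans e₂, fun U hP y φ s hs => ?_⟩
  have h := TopCat.Presheaf.stalkFunctor_map_germ_apply U P hP (toStructureSheaf T) (sec U φ s hs)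
  have h' : e₁.symm ((structureSheaf T).presheaf.germ U P hP
      ((toStructureSheaf T).app (op U) (sec U φ s hs))) =
      (structurePresheaf T).germ U P hP (sec U φ s hs) := by
    exact e₁.symm_apply_eq.2 h.symm
  refine (congrArg e₂ h').trans ?_
  exact stalkDesc_germ_sec P U hP φ s hs

/-- Under `exists_stalkEquiv` the stalk map at `P` becomes the ring homomorphism induced by `F` from
`T/F⁻¹P` to `T'/P`. Germs of fractions exhaust the stalk, so the comparison is made on them. -/
lemma isIso_stalkMap_of_bijective (P : Spc T')
    (h : Function.Bijective (mapRing F (I := (Spc.comap F P).ideal) (J := P.ideal) le_rfl)) :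
    IsIso ((Spec.map F).stalkMap P) := by
  obtain ⟨e, he⟩ := exists_stalkEquiv T (Spc.comap F P)
  obtain ⟨e', he'⟩ := exists_stalkEquiv T' P
  have key : ∀ x, e' ((Spec.map F).stalkMap P x) = mapRing F le_rfl (e x) := by
    intro x
    obtain ⟨U, hP, y, φ, s, hs, rfl⟩ := exists_germ_toStructureSheaf (Spc.comap F P) x
    have h1 := AlgebraicGeometry.LocallyRingedSpace.stalkMap_germ_apply (Spec.map F) U P hP
      ((toStructureSheaf T).app (op U) (sec U φ s hs))
    have h3 := (toStructureSheaf_map_app F U (sec U φ s hs)).trans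
      (congrArg _ (structurePresheafMap_sec F U φ s hs))
    refine Eq.trans ?_ ((congrArg (mapRing F le_rfl) (he U hP φ s hs)).trans
      (mapRing_frac F le_rfl φ s _)).symm
    refine Eq.trans (congrArg e' (h1.trans (congrArg _ h3))) ?_
    exact he' ((Opens.map (Spc.comapHom F)).obj U) hP _ _ _
  have hb : Function.Bijective ((Spec.map F).stalkMap P).hom := by
    have : ⇑((Spec.map F).stalkMap P).hom = e'.symm ∘ mapRing F le_rfl ∘ e :=
      funext fun x => (e'.symm_apply_eq.2 (key x).symm).symm
    rw [this]
    exact e'.symm.bijective.comp (h.comp e.bijective)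
  exact (ConcreteCategory.isIso_iff_bijective _).2 hb

variable {D : Type u} [Category.{u} D] (L : T ⥤ D) (I : ObjectProperty T) [IsTTIdeal I]
  [L.IsLocalization I.trW]

lemma isIso_stalkMap_toTTQuotient (P : Spc (TTQuotient L I)) :
    IsIso ((Spec.map (toTTQuotient L I)).stalkMap P) :=
  isIso_stalkMap_of_bijective _ P (bijective_mapRing_toTTQuotient L I P.ideal)

end StalkMap

end TTGeometry

namespace TTGeometry

/-! ### Naturality of the comparison morphism. -/

section Square

variable {T : Type u} [Category.{u} T] [HasZeroObject T] [HasShift T ℤ] [Preadditive T]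
  [∀ n : ℤ, (shiftFunctor T n).Additive] [Pretriangulated T]
  [MonoidalCategory T] [SymmetricCategory T]
  {T' : Type u} [Category.{u} T'] [HasZeroObject T'] [HasShift T' ℤ] [Preadditive T']
  [∀ n : ℤ, (shiftFunctor T' n).Additive] [Pretriangulated T']
  [MonoidalCategory T'] [SymmetricCategory T']
  (F : T ⥤ T') [F.Monoidal] [F.CommShift ℤ] [F.IsTriangulated]
  [IsTensorTriangulated T] [IsTriangulated T] [IsTensorTriangulated T'] [IsTriangulated T']

/-- The ring homomorphism between central rings induced by a tensor triangulated functor. -/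
noncomputable def centralRingMap : End (𝟙_ T) →+* End (𝟙_ T') :=
  haveI : F.Additive := inferInstance
  endUnitMap F (Functor.Monoidal.εIso F).symm

lemma frac_congr_comp (J : ObjectProperty T) [IsTTIdeal J] {y y' : T} (φ s : 𝟙_ T ⟶ y)
    (hs : J.trW s) (i : y ⟶ y') [IsIso i] (hs' : J.trW (s ≫ i)) :
    frac J (φ ≫ i) (s ≫ i) hs' = frac J φ s hs := by
  have h1 := isIso_toVerdier_map J s hs
  have h2 := isIso_toVerdier_map J _ hs'
  change (toVerdier J).map (φ ≫ i) ≫ inv ((toVerdier J).map (s ≫ i)) =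
    (toVerdier J).map φ ≫ inv ((toVerdier J).map s)
  rw [← cancel_mono ((toVerdier J).map (s ≫ i)), Category.assoc, IsIso.inv_hom_id,
    Category.comp_id, Functor.map_comp, Functor.map_comp, Category.assoc,
    IsIso.inv_hom_id_assoc]

/-- Both sides send `r` to the section given by `F(r)`. One route yields a fraction with target
`F(𝟙)`, the other a fraction with target `𝟙`; `frac_congr_comp` reconciles them. -/
lemma toGlobalSections_comp_map :
    toGlobalSections T ≫ AlgebraicGeometry.LocallyRingedSpace.Γ.map (Spec.map F).op =
      CommRingCat.ofHom (centralRingMap F) ≫ toGlobalSections T' := by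
  ext r
  have h1 : toGlobalSections T r = (toStructureSheaf T).app (op ⊤)
      (sec ⊤ r (𝟙 _) (ObjectProperty.trW_of_isIso _ _)) :=
    congrArg ((toStructureSheaf T).app (op ⊤)) (endUnitMap_toVerdier _ r)
  have h2 : toGlobalSections T' (centralRingMap F r) = (toStructureSheaf T').app (op ⊤)
      (sec ⊤ (centralRingMap F r) (𝟙 _) (ObjectProperty.trW_of_isIso _ _)) :=
    congrArg ((toStructureSheaf T').app (op ⊤)) (endUnitMap_toVerdier _ _)
  have h3 := (toStructureSheaf_map_app F ⊤ (sec ⊤ r (𝟙 _) (ObjectProperty.trW_of_isIso _ _))).trans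
      (congrArg _ (structurePresheafMap_sec F ⊤ r (𝟙 _) (ObjectProperty.trW_of_isIso _ _)))
  refine (congrArg ((structureSheafMap F).app (op ⊤)) h1).trans (h3.trans (Eq.trans ?_ h2.symm))
  refine congrArg ((toStructureSheaf T').app (op ⊤)) ?_
  -- Expanding by the counit isomorphism `η : F(𝟙) ⟶ 𝟙` makes the denominator `ε ≫ F(𝟙) ≫ η` the
  -- identity.
  have h4 := frac_congr_comp (idealOff ((⊤ : Opens (TopCat.of (Spc T'))) : Set (Spc T')))
    (Functor.LaxMonoidal.ε F ≫ F.map r) (Functor.LaxMonoidal.ε F ≫ F.map (𝟙 _))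
    (trW_ε_comp F (idealOff_le_inverseImage F (U := Set.univ)) (𝟙 _)
      (ObjectProperty.trW_of_isIso _ _))
    (Functor.OplaxMonoidal.η F) (ObjectProperty.trW_of_isIso _ _)
  refine h4.symm.trans ?_
  have h5 : (Functor.LaxMonoidal.ε F ≫ F.map (𝟙 _)) ≫ Functor.OplaxMonoidal.η F = 𝟙 _ := by simp
  change frac _ _ _ _ = frac _ (Functor.LaxMonoidal.ε F ≫ F.map r ≫ Functor.OplaxMonoidal.η F) _ _
  congr 1
  exact Category.assoc _ _ _

/-- The comparison morphism is natural in the tensor triangulated category. -/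
lemma map_comp_rho : Spec.map F ≫ rho T =
    rho T' ≫ AlgebraicGeometry.Spec.toLocallyRingedSpace.{u}.map
      (CommRingCat.ofHom (centralRingMap F)).op := by
  -- Both composites are transposes under the adjunction between global sections and `Spec`, so it
  -- is enough to compare ring homomorphisms into global sections.
  have h1 := AlgebraicGeometry.ΓSpec.locallyRingedSpaceAdjunction.homEquiv_naturality_left
    (Spec.map F) (toGlobalSections T).op
  have h2 := AlgebraicGeometry.ΓSpec.locallyRingedSpaceAdjunction.homEquiv_naturality_right
    (toGlobalSections T').op (CommRingCat.ofHom (centralRingMap F)).op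
  refine h1.symm.trans (Eq.trans (congrArg _ ?_) h2)
  exact congrArg Quiver.Hom.op (toGlobalSections_comp_map F)

end Square

/-! ### The cartesian square and the restricted structure sheaf. -/

section CentralLocalization

variable {T : Type u} [Category.{u} T] [HasZeroObject T] [HasShift T ℤ] [Preadditive T]
  [∀ n : ℤ, (shiftFunctor T n).Additive] [Pretriangulated T]
  [MonoidalCategory T] [SymmetricCategory T] [IsTensorTriangulated T] [IsTriangulated T]
  (S : Submonoid (End (𝟙_ T)))

/-- A localization of rings is an epimorphism, hence a monomorphism in the opposite category, and
`Spec` preserves monomorphisms as a right adjoint. -/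
lemma mono_spec_centralMap : Mono (AlgebraicGeometry.Spec.toLocallyRingedSpace.{u}.map
    (CommRingCat.ofHom (centralMap S)).op) := by
  algebraize [centralMap S]
  have : IsLocalization S (End (𝟙_ (CentralLocalization S))) := isLocalization_centralMap S
  have : Epi (CommRingCat.ofHom (centralMap S)) :=
    IsLocalization.epi S (End (𝟙_ (CentralLocalization S)))
  have := AlgebraicGeometry.ΓSpec.locallyRingedSpaceAdjunction.{u}.isRightAdjoint
  infer_instance

/-- The spectrum of `S⁻¹T` is the base change of the spectrum of `T` along the localization of
central rings at `S`. -/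
theorem isPullback_rho : IsPullback (Spec.map (toCentralLocalization S))
    (rho (CentralLocalization S)) (rho T)
    (AlgebraicGeometry.Spec.toLocallyRingedSpace.{u}.map
      (CommRingCat.ofHom (centralMap S)).op) := by
  have := mono_spec_centralMap S
  refine isPullback_of_isEmbedding (map_comp_rho (toCentralLocalization S))
    (isEmbedding_comap_toTTQuotient _ _) (isIso_stalkMap_toTTQuotient _ _) ?_
  -- If `ρ(P)` is the contraction of a prime `p` of the localized ring, an `s ∈ S` lying in `ρ(P)`
  -- would give a unit in `p`.
  rintro P ⟨p, hp⟩
  refine (Set.ext_iff.1 (range_comap_toCentralLocalization S) P).2 fun s hs h => ?_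
  have h' : s ∈ PrimeSpectrum.asIdeal (PrimeSpectrum.comap (centralMap S) p) :=
    (congrArg (fun q => s ∈ PrimeSpectrum.asIdeal q) hp).mpr h
  exact p.isPrime.ne_top (Ideal.eq_top_of_isUnit_mem _ h' (isUnit_centralMap S hs))

/-- The structure sheaf of the spectrum of `S⁻¹T` is the restriction of the structure sheaf of
the spectrum of `T`. -/
theorem isIso_pullbackStructureSheafMap : IsIso (pullbackStructureSheafMap S) :=
  isIso_pullback_homEquiv_symm (locBase S) (structureSheaf T)
    (structureSheaf (CentralLocalization S)) ⟨structureSheafMap (toCentralLocalization S)⟩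
    (isIso_stalkMap_toTTQuotient _ (torsion S))

end CentralLocalization

end TTGeometry

theorem mainTheorem12 (T : Type u) [Category.{u} T] [HasZeroObject T] [HasShift T ℤ]
    [Preadditive T] [∀ n : ℤ, (shiftFunctor T n).Additive] [Pretriangulated T] [IsTriangulated T]
    [MonoidalCategory T] [SymmetricCategory T] [TTGeometry.IsTensorTriangulated T]
    [RigidCategory T] (S : Submonoid (End (𝟙_ T))) :
    @IsLocalization (End (𝟙_ T)) _ S (End (𝟙_ (TTGeometry.CentralLocalization S))) _
        (TTGeometry.centralMap S).toAlgebra ∧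
      IsPullback
        (TTGeometry.Spec.map (TTGeometry.toCentralLocalization S))
        (TTGeometry.rho (TTGeometry.CentralLocalization S))
        (TTGeometry.rho T)
        (AlgebraicGeometry.Spec.toLocallyRingedSpace.{u}.map
          (CommRingCat.ofHom (TTGeometry.centralMap S)).op) ∧
      Topology.IsEmbedding (TTGeometry.Spc.comap (TTGeometry.toCentralLocalization S)) ∧
      Set.range (TTGeometry.Spc.comap (TTGeometry.toCentralLocalization S)) =
        {P : TTGeometry.Spc T |
          ∀ s ∈ S, s ∉ PrimeSpectrum.asIdeal ((TTGeometry.rho T).base P)} ∧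
      IsIso (TTGeometry.pullbackStructureSheafMap S) :=
  ⟨TTGeometry.isLocalization_centralMap S, TTGeometry.isPullback_rho S,
    TTGeometry.isEmbedding_comap_toTTQuotient _ _, TTGeometry.range_comap_toCentralLocalization S,
    TTGeometry.isIso_pullbackStructureSheafMap S⟩
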